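/- Let $(R,\mathfrak m)$ and $(S,\mathfrak n)$ be Noetherian commutative local rings and let $R\to S$ be a local ring homomorphism (one that maps $\mathfrak m$ into $\mathfrak n$). Write $\dim$ for Krull dimension and $\operatorname{edim}$ for embedding dimension, i.e. the minimal number of generators of the maximal ideal. Suppose that $S$ has finite flat dimension as an $R$-module, i.e. for some $n\ge 0$ there is an exact sequence of $R$-modules $0\to F_n\to\cdots\to F_1\to F_0\to S\to 0$ with every $F_i$ flat over $R$. Then $$\operatorname{edim} R-\dim R\le \operatorname{edim} S-\dim S .$$ In particular, if $\dim S\ge\dim R$ (which holds, for example, if $S$ is flat over $R$), then $\operatorname{edim} S\ge\operatorname{edim} R$. -/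

import Mathlib

universe u v

/-- The embedding dimension of a local ring: the minimal number of generators of its
maximal ideal. -/
noncomputable def embDim (R : Type u) [CommRing R] [IsLocalRing R] : ℕ :=
  (IsLocalRing.maximalIdeal R).spanFinrank

/-- The Krull dimension of a ring as a natural number. It is meaningful for nonzero rings of
finite Krull dimension, in particular for Noetherian local rings: see `coe_dimNat`. -/
noncomputable def dimNat (R : Type u) [CommRing R] : ℕ :=
  ((ringKrullDim R).unbotD 0).toNat

theorem coe_dimNat (R : Type u) [CommRing R] [IsLocalRing R] [IsNoetherianRing R] :
    ((dimNat R : ℕ) : WithBot ℕ∞) = ringKrullDim R := by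
  have hb : ringKrullDim R ≠ ⊥ := ringKrullDim_ne_bot
  have ht : ringKrullDim R ≠ ⊤ := ringKrullDim_ne_top
  obtain ⟨d, hd⟩ := WithBot.ne_bot_iff_exists.mp hb
  have hd' : d ≠ ⊤ := by
    rintro rfl
    exact ht hd.symm
  obtain ⟨n, rfl⟩ := ENat.ne_top_iff_exists.mp hd'
  simp only [dimNat, ← hd, WithBot.unbotD_coe, ENat.toNat_natCast]
  rfl

/-- `M` has flat dimension at most `n` over `R`: there is an exact sequence
`0 → F n → ⋯ → F 1 → F 0 → M → 0` of `R`-modules with every `F i` flat. -/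
def HasFlatDimensionLE (R : Type u) [CommRing R] (M : Type v) [AddCommGroup M] [Module R M]
    (n : ℕ) : Prop :=
  ∃ (F : ℕ → Type (max u v)) (_ : ∀ i, AddCommGroup (F i)) (_ : ∀ i, Module R (F i))
    (d : ∀ i, F (i + 1) →ₗ[R] F i) (ε : F 0 →ₗ[R] M),
    (∀ i, Module.Flat R (F i)) ∧ (∀ i, n < i → Subsingleton (F i)) ∧
    Function.Surjective ε ∧ Function.Exact (d 0) ε ∧
    ∀ i, Function.Exact (d (i + 1)) (d i)

/-- `M` has finite flat dimension over `R`: it has a flat resolution of finite length. -/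
def HasFiniteFlatDimension (R : Type u) [CommRing R] (M : Type v) [AddCommGroup M]
    [Module R M] : Prop :=
  ∃ n : ℕ, HasFlatDimensionLE R M n

-- Suppose first that `A → S` is surjective with kernel `J` and that `S` has a finite free
-- resolution over `A`. The resolution forces `J` to be zero or to contain a nonzerodivisor
-- (`FinFreeRes.ideal_eq_bot_or`). If edim A > edim S, then `J` is not inside 𝔪², and prime
-- avoidance gives a regular `f ∈ J` outside 𝔪². By an argument of Nagata (`finFreeRes_quotient`),
-- `S` keeps a finite free resolution over `A/f`. Since edim drops by at most one and dim by at
-- least one, induction gives the inequality (`ringKrullDim_add_le_of_surjective`).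
--
-- The general case reduces to this one by a Cohen factorization. Completing `S` preserves edim and
-- does not lower dim, so `S` may be taken complete. Adjoining to `R` one variable for each
-- generator of 𝔫 yields a maximal ideal `q` with `qS = 𝔫`. Each variable raises by one both the
-- number `g` of elements of `q` independent modulo `q²` and the number `d` of elements generating
-- `q` up to radical. Finite flat dimension survives because `S = S[X]/(X - x)`.
--
-- For such `q` there is a Noetherian local ring `A`, flat over the base, with `qA` maximal and `A →
-- S` surjective (`exists_flat_isLocalRing_surjective`). Then edim A ≥ g and dim A ≤ d, and finite
-- flat dimension over the base becomes a finite free resolution over `A`. To build `A`, the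
-- transcendental part of the residue extension comes from localizing a polynomial ring, the
-- algebraic part from lifting minimal polynomials one at a time, and a final completion restores
-- the Noetherian property and flatness.

universe w

open Function TensorProduct IsLocalRing

/-! ### Flat dimension through vanishing of Tor, without derived functors. -/

section TorVanishing

variable (R : Type u) [CommRing R]

/-- The canonical free cover of a module. -/
noncomputable def freeCover (N : Type v) [AddCommGroup N] [Module R N] : (N →₀ R) →ₗ[R] N :=
  Finsupp.linearCombination R id

theorem freeCover_surjective (N : Type v) [AddCommGroup N] [Module R N] :
    Surjective (freeCover R N) :=
  fun x => ⟨Finsupp.single x 1, by simp [freeCover]⟩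

/-- The canonical first syzygy of a module. -/
noncomputable abbrev Syz (N : Type v) [AddCommGroup N] [Module R N] : Submodule R (N →₀ R) :=
  LinearMap.ker (freeCover R N)

/-- `Tor₁(M, N) = 0`, expressed through the canonical free cover of `N`. -/
def TorOneZero (M : Type w) [AddCommGroup M] [Module R M] (N : Type v) [AddCommGroup N]
    [Module R N] : Prop :=
  Injective ((Syz R N).subtype.lTensor M)

/-- `Torₙ₊₁(M, N) = 0`, expressed through canonical syzygies of `N`. -/
def TorZero (M : Type w) [AddCommGroup M] [Module R M] :
    ℕ → ∀ (N : Type u) [AddCommGroup N] [Module R N], Prop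
  | 0, N, _, _ => TorOneZero R M N
  | n + 1, N, _, _ => TorZero M n (Syz R N)

/-- The flat dimension of `M` is at most `n`, expressed through vanishing of `Torₙ₊₁`. -/
def FlatDimLE (n : ℕ) (M : Type w) [AddCommGroup M] [Module R M] : Prop :=
  ∀ (N : Type u) [AddCommGroup N] [Module R N], TorZero R M n N

variable {R}

theorem exact_syz (N : Type v) [AddCommGroup N] [Module R N] :
    Exact (Syz R N).subtype (freeCover R N) :=
  LinearMap.exact_subtype_ker_map _

/-- Balance of `Tor₁` for two presentations. -/
theorem lTensor_injective_iff_of_exact {K F L W P N : Type*} [AddCommGroup K] [Module R K]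
    [AddCommGroup F] [Module R F] [AddCommGroup L] [Module R L] [AddCommGroup W] [Module R W]
    [AddCommGroup P] [Module R P] [AddCommGroup N] [Module R N]
    {i : K →ₗ[R] F} {p : F →ₗ[R] L} {j : W →ₗ[R] P} {q : P →ₗ[R] N}
    (hip : Exact i p) (hp : Surjective p) (hjq : Exact j q) (hq : Surjective q)
    (hiP : Injective (i.rTensor P)) (hFj : Injective (j.lTensor F)) :
    Injective (j.lTensor L) ↔ Injective (i.rTensor N) := by
  constructor
  · intro h
    rw [← LinearMap.lTensor_inj_iff_rTensor_inj]
    refine lTensor_injective_of_exact_of_exact_of_rTensor_injective hjq hq hip hp ?_ ?_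
    · rwa [← LinearMap.lTensor_inj_iff_rTensor_inj]
    · rwa [LinearMap.lTensor_inj_iff_rTensor_inj]
  · intro h
    exact lTensor_injective_of_exact_of_exact_of_rTensor_injective hip hp hjq hq h hFj

/-- Both sides are compared with injectivity on the canonical presentation of `M` tensored with `N`,
so the flat presentation of `N` is immaterial. -/
theorem torOneZero_iff_of_flat_right (M : Type w) [AddCommGroup M] [Module R M]
    {W P N : Type*} [AddCommGroup W] [Module R W]
    [AddCommGroup P] [Module R P] [AddCommGroup N] [Module R N] [Module.Flat R P]
    {j : W →ₗ[R] P} {q : P →ₗ[R] N} (hj : Injective j) (hjq : Exact j q) (hq : Surjective q) :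
    TorOneZero R M N ↔ Injective (j.lTensor M) := by
  have h1 := lTensor_injective_iff_of_exact (exact_syz (R := R) M) (freeCover_surjective R M)
    (exact_syz (R := R) N) (freeCover_surjective R N)
    (Module.Flat.rTensor_preserves_injective_linearMap _ (Submodule.injective_subtype _))
    (Module.Flat.lTensor_preserves_injective_linearMap _ (Submodule.injective_subtype _))
  have h2 := lTensor_injective_iff_of_exact (exact_syz (R := R) M) (freeCover_surjective R M)
    hjq hq
    (Module.Flat.rTensor_preserves_injective_linearMap _ (Submodule.injective_subtype _))
    (Module.Flat.lTensor_preserves_injective_linearMap _ hj)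
  exact h1.trans h2.symm

theorem torOneZero_iff_of_left {K F L : Type*} [AddCommGroup K] [Module R K]
    [AddCommGroup F] [Module R F] [AddCommGroup L] [Module R L]
    {i : K →ₗ[R] F} {p : F →ₗ[R] L} (hi : Injective i) (hip : Exact i p) (hp : Surjective p)
    (N : Type*) [AddCommGroup N] [Module R N] (hF : TorOneZero R F N) :
    TorOneZero R L N ↔ Injective (i.rTensor N) := by
  have h1 : Injective (i.rTensor (N →₀ R)) :=
    Module.Flat.rTensor_preserves_injective_linearMap _ hi
  exact lTensor_injective_iff_of_exact (W := Syz R N) hip hp (exact_syz (R := R) N)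
    (freeCover_surjective R N) h1 hF

theorem TorOneZero.of_flat (M : Type*) [AddCommGroup M] [Module R M] [Module.Flat R M]
    (N : Type*) [AddCommGroup N] [Module R N] : TorOneZero R M N :=
  Module.Flat.lTensor_preserves_injective_linearMap _ (Submodule.injective_subtype _)

theorem TorZero.of_flat (M : Type*) [AddCommGroup M] [Module R M] [Module.Flat R M] (n : ℕ)
    (N : Type u) [AddCommGroup N] [Module R N] : TorZero R M n N := by
  induction n generalizing N with
  | zero => exact TorOneZero.of_flat M N
  | succ n ih => exact ih _

theorem TorOneZero.of_equiv {M M' : Type*} [AddCommGroup M] [Module R M] [AddCommGroup M']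
    [Module R M'] (e : M ≃ₗ[R] M') {N : Type*} [AddCommGroup N] [Module R N]
    (h : TorOneZero R M N) : TorOneZero R M' N := by
  have hc : (Syz R N).subtype.lTensor M' ∘ₗ e.toLinearMap.rTensor _ =
      e.toLinearMap.rTensor _ ∘ₗ (Syz R N).subtype.lTensor M := by
    ext; simp
  have h1 : Injective ((Syz R N).subtype.lTensor M' ∘ₗ e.toLinearMap.rTensor _) := by
    rw [hc, LinearMap.coe_comp]
    exact (LinearEquiv.rTensor _ e).injective.comp h
  rw [LinearMap.coe_comp] at h1
  exact (Injective.of_comp_iff' _ (LinearEquiv.rTensor (Syz R N) e).bijective).mp h1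

theorem TorZero.of_equiv {M M' : Type*} [AddCommGroup M] [Module R M] [AddCommGroup M']
    [Module R M'] (e : M ≃ₗ[R] M') {n : ℕ} {N : Type u} [AddCommGroup N] [Module R N]
    (h : TorZero R M n N) : TorZero R M' n N := by
  induction n generalizing N with
  | zero => exact TorOneZero.of_equiv e h
  | succ n ih => exact ih h

theorem FlatDimLE.of_equiv {M M' : Type*} [AddCommGroup M] [Module R M] [AddCommGroup M']
    [Module R M'] (e : M ≃ₗ[R] M') {n : ℕ} (h : FlatDimLE R n M) : FlatDimLE R n M' :=
  fun N _ _ => (h N).of_equiv e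

theorem flatDimLE_zero_iff (M : Type*) [AddCommGroup M] [Module R M] :
    FlatDimLE R 0 M ↔ Module.Flat R M := by
  refine ⟨fun h => ?_, fun h N _ _ => TorZero.of_flat M 0 N⟩
  rw [Module.Flat.iff_lTensor_injective']
  intro I
  exact (torOneZero_iff_of_flat_right M (Submodule.injective_subtype I)
    (LinearMap.exact_subtype_mkQ I) (Submodule.mkQ_surjective I)).mp (h (R ⧸ I))

section Shift

variable {K F L : Type*} [AddCommGroup K] [Module R K]
  [AddCommGroup F] [Module R F] [AddCommGroup L] [Module R L]
  {i : K →ₗ[R] F} {p : F →ₗ[R] L}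

/-- Dimension shift: the two composites around the square from `K ⊗ Syz N` to `F ⊗ (N →₀ R)` agree,
and the second map of each is injective. -/
theorem torOneZero_syz_iff (hi : Injective i) (hip : Exact i p) (hp : Surjective p)
    (N : Type*) [AddCommGroup N] [Module R N] (hF : TorOneZero R F N)
    (hF' : TorOneZero R F (Syz R N)) :
    TorOneZero R L (Syz R N) ↔ TorOneZero R K N := by
  rw [torOneZero_iff_of_left hi hip hp _ hF']
  have hc : i.rTensor (N →₀ R) ∘ₗ (Syz R N).subtype.lTensor K =
      (Syz R N).subtype.lTensor F ∘ₗ i.rTensor (Syz R N) := by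
    ext; simp
  have h1 : Injective (i.rTensor (N →₀ R)) :=
    Module.Flat.rTensor_preserves_injective_linearMap _ hi
  have e1 : Injective (i.rTensor (N →₀ R) ∘ₗ (Syz R N).subtype.lTensor K) ↔
      TorOneZero R K N := by
    rw [LinearMap.coe_comp]
    exact h1.of_comp_iff _
  have e2 : Injective ((Syz R N).subtype.lTensor F ∘ₗ i.rTensor (Syz R N)) ↔
      Injective (i.rTensor (Syz R N)) := by
    rw [LinearMap.coe_comp]
    exact Injective.of_comp_iff hF _
  rw [← e1, ← e2, hc]

theorem torZero_succ_iff (hi : Injective i) (hip : Exact i p) (hp : Surjective p)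
    (n : ℕ) (N : Type u) [AddCommGroup N] [Module R N] (hF : ∀ j, TorZero R F j N) :
    TorZero R L (n + 1) N ↔ TorZero R K n N := by
  induction n generalizing N with
  | zero => exact torOneZero_syz_iff hi hip hp N (hF 0) (hF 1)
  | succ n ih => exact ih (Syz R N) fun j => hF (j + 1)

theorem flatDimLE_succ_iff [Module.Flat R F] (hi : Injective i) (hip : Exact i p)
    (hp : Surjective p) (n : ℕ) : FlatDimLE R (n + 1) L ↔ FlatDimLE R n K :=
  forall_congr' fun N => forall_congr' fun _ => forall_congr' fun _ =>
    torZero_succ_iff hi hip hp n N fun j => TorZero.of_flat F j N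

/-- Here `F` need not be flat, so only one direction of the dimension shift remains. This is the
loss of one incurred for each adjoined variable. -/
theorem FlatDimLE.of_shortExact {n : ℕ} (hi : Injective i) (hip : Exact i p)
    (hp : Surjective p) (hK : FlatDimLE R n K) (hF : FlatDimLE R n F) :
    FlatDimLE R (n + 1) L := by
  have key : ∀ (N : Type u) [AddCommGroup N] [Module R N], TorOneZero R K N →
      TorOneZero R F (Syz R N) → TorOneZero R L (Syz R N) := by
    intro N _ _ h1 h2
    rw [torOneZero_iff_of_left hi hip hp _ h2]
    have hc : i.rTensor (N →₀ R) ∘ₗ (Syz R N).subtype.lTensor K =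
        (Syz R N).subtype.lTensor F ∘ₗ i.rTensor (Syz R N) := by
      ext; simp
    have h3 : Injective ((Syz R N).subtype.lTensor F ∘ₗ i.rTensor (Syz R N)) := by
      rw [← hc, LinearMap.coe_comp]
      exact (Module.Flat.rTensor_preserves_injective_linearMap _ hi).comp h1
    rw [LinearMap.coe_comp] at h3
    exact h3.of_comp
  have main : ∀ (n : ℕ) (N : Type u) [AddCommGroup N] [Module R N], TorZero R K n N →
      TorZero R F (n + 1) N → TorZero R L (n + 1) N := by
    intro n
    induction n with
    | zero => intro N _ _ h1 h2; exact key N h1 h2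
    | succ n ih => intro N _ _ h1 h2; exact ih (Syz R N) h1 h2
  exact fun N _ _ => main n N (hK N) (hF (Syz R N))

end Shift

/-- `S' ⊗_R N` is `S' ⊗_S (S ⊗_R N)`, and `S' ⊗_S -` preserves injections. Needed to replace `S` by
its completion. -/
theorem TorOneZero.tensor_of_flat {S S' : Type*} [CommRing S] [CommRing S'] [Algebra R S]
    [Algebra R S'] [Algebra S S'] [IsScalarTower R S S'] [Module.Flat S S']
    {N : Type*} [AddCommGroup N] [Module R N] (h : TorOneZero R S N) : TorOneZero R S' N := by
  have h1 : Injective (((Syz R N).subtype.baseChange S).lTensor S') :=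
    Module.Flat.lTensor_preserves_injective_linearMap _ h
  let e := AlgebraTensorModule.cancelBaseChange R S S S' (Syz R N)
  let e' := AlgebraTensorModule.cancelBaseChange R S S S' (N →₀ R)
  have hc : ∀ x, e' (((Syz R N).subtype.baseChange S).lTensor S' x) =
      (Syz R N).subtype.lTensor S' (e x) := by
    intro x
    induction x with
    | zero => simp
    | add x y hx hy => simp only [map_add, hx, hy]
    | tmul s y =>
      induction y with
      | zero => simp
      | add x y hx hy => simp only [tmul_add, map_add, hx, hy]
      | tmul t z => simp [e, e']
  have h2 : Injective (fun x => (Syz R N).subtype.lTensor S' (e x)) := by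
    simp_rw [← hc]
    exact e'.injective.comp h1
  exact (Injective.of_comp_iff' _ e.bijective).mp h2

theorem FlatDimLE.of_flat_algebra {S S' : Type*} [CommRing S] [CommRing S'] [Algebra R S]
    [Algebra R S'] [Algebra S S'] [IsScalarTower R S S'] [Module.Flat S S'] {n : ℕ}
    (h : FlatDimLE R n S) : FlatDimLE R n S' := by
  have main : ∀ (n : ℕ) (N : Type u) [AddCommGroup N] [Module R N], TorZero R S n N →
      TorZero R S' n N := by
    intro n
    induction n with
    | zero => intro N _ _ h1; exact TorOneZero.tensor_of_flat h1
    | succ n ih => intro N _ _ h1; exact ih (Syz R N) h1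
  exact fun N _ _ => main n N (h N)

theorem FlatDimLE.baseChange_of_shortExact {R' : Type u} [CommRing R'] [Algebra R R']
    [Module.Flat R R'] {K F L : Type*} [AddCommGroup K] [Module R K]
    [AddCommGroup F] [Module R F] [AddCommGroup L] [Module R L] [Module.Flat R F]
    {i : K →ₗ[R] F} {p : F →ₗ[R] L} (hi : Injective i) (hip : Exact i p) (hp : Surjective p)
    {n : ℕ} (h : FlatDimLE R' n (R' ⊗[R] K)) : FlatDimLE R' (n + 1) (R' ⊗[R] L) := by
  have h1 : Injective (i.baseChange R') :=
    Module.Flat.lTensor_preserves_injective_linearMap (M := R') _ hi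
  have h2 : Exact (i.baseChange R') (p.baseChange R') := lTensor_exact R' hip hp
  have h3 : Surjective (p.baseChange R') := LinearMap.lTensor_surjective R' hp
  exact (flatDimLE_succ_iff h1 h2 h3 n).mpr h

theorem FlatDimLE.baseChange {R' : Type u} [CommRing R'] [Algebra R R'] [Module.Flat R R']
    {n : ℕ} {M : Type (max u w)} [AddCommGroup M] [Module R M] (h : FlatDimLE R n M) :
    FlatDimLE R' n (R' ⊗[R] M) := by
  induction n generalizing M with
  | zero =>
    rw [flatDimLE_zero_iff] at h ⊢
    infer_instance
  | succ n ih =>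
    have hi : Injective (Syz R M).subtype := Submodule.injective_subtype _
    rw [flatDimLE_succ_iff (K := Syz R M) hi (exact_syz M) (freeCover_surjective R M)] at h
    exact FlatDimLE.baseChange_of_shortExact (K := Syz R M) hi (exact_syz M)
      (freeCover_surjective R M) (ih h)

/-- The induction replaces `M` by `ker ε` inside `F 0`, which lives in `Type (max u v)`. Hence the
universe of `M`, which `ULift` later frees. -/
theorem FlatDimLE.of_hasFlatDimensionLE_aux {n : ℕ} {M : Type (max u v)} [AddCommGroup M]
    [Module R M] (h : HasFlatDimensionLE.{u, max u v} R M n) : FlatDimLE R n M := by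
  induction n generalizing M with
  | zero =>
    obtain ⟨F, _, _, d, ε, hflat, hsub, hε, h0, -⟩ := h
    rw [flatDimLE_zero_iff]
    have := hflat 0
    have := hsub 1 one_pos
    have hinj : Injective ε := by
      rw [injective_iff_map_eq_zero]
      intro x hx
      obtain ⟨y, rfl⟩ := (h0 x).mp hx
      rw [Subsingleton.elim y 0, map_zero]
    exact Module.Flat.of_linearEquiv (LinearEquiv.ofBijective ε ⟨hinj, hε⟩).symm
  | succ n ih =>
    obtain ⟨F, _, _, d, ε, hflat, hsub, hε, h0, hd⟩ := h
    have := hflat 0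
    rw [flatDimLE_succ_iff (Submodule.injective_subtype (LinearMap.ker ε))
      (LinearMap.exact_subtype_ker_map ε) hε]
    refine ih ⟨fun i => F (i + 1), inferInstance, inferInstance, fun i => d (i + 1),
      (d 0).codRestrict _ fun x => (h0 _).mpr ⟨x, rfl⟩, fun i => hflat _,
      fun i hi => hsub _ (by omega), ?_, ?_, fun i => hd _⟩
    · rintro ⟨x, hx⟩
      obtain ⟨y, rfl⟩ := (h0 x).mp hx
      exact ⟨y, rfl⟩
    · intro x
      rw [← hd 0 x, Subtype.ext_iff]
      rfl

theorem FlatDimLE.of_hasFlatDimensionLE {n : ℕ} {M : Type v} [AddCommGroup M]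
    [Module R M] (h : HasFlatDimensionLE.{u, v} R M n) : FlatDimLE R n M := by
  obtain ⟨F, _, _, d, ε, hflat, hsub, hε, h0, hd⟩ := h
  refine FlatDimLE.of_equiv (ULift.moduleEquiv.{u, v, max u v} (R := R) (M := M))
    (FlatDimLE.of_hasFlatDimensionLE_aux.{u, v}
    ⟨F, inferInstance, inferInstance, d, ULift.moduleEquiv.symm.toLinearMap ∘ₗ ε, hflat, hsub,
      ?_, ?_, hd⟩)
  · exact ULift.moduleEquiv.symm.surjective.comp hε
  · intro x
    rw [← h0 x]
    exact ULift.moduleEquiv.symm.map_eq_zero_iff (x := ε x)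

end TorVanishing

/-! ### Finite free resolutions and ranks at associated primes. -/

section FiniteFreeResolution

/-- `M` has a resolution of length at most `n` by finite free `A`-modules. -/
def FinFreeRes (A : Type u) [CommRing A] :
    ℕ → ∀ (M : Type u) [AddCommGroup M] [Module A M], Prop
  | 0, M, _, _ => Module.Free A M ∧ Module.Finite A M
  | n + 1, M, _, _ => ∃ (r : ℕ) (g : (Fin r → A) →ₗ[A] M), Surjective g ∧
      FinFreeRes A n (LinearMap.ker g)

theorem FinFreeRes.flatDimLE {A : Type u} [CommRing A] {n : ℕ} {M : Type u} [AddCommGroup M]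
    [Module A M] (h : FinFreeRes A n M) : FlatDimLE A n M := by
  induction n generalizing M with
  | zero =>
    have := h.1
    rw [flatDimLE_zero_iff]
    infer_instance
  | succ n ih =>
    obtain ⟨r, g, hg, h⟩ := h
    exact (flatDimLE_succ_iff (K := LinearMap.ker g) (Submodule.injective_subtype _)
      (LinearMap.exact_subtype_ker_map g) hg n).mpr (ih h)

theorem FinFreeRes.finite {A : Type u} [CommRing A] {n : ℕ} {M : Type u} [AddCommGroup M]
    [Module A M] (h : FinFreeRes A n M) : Module.Finite A M := by
  cases n with
  | zero => exact h.2
  | succ n =>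
    obtain ⟨r, g, hg, -⟩ := h
    exact Module.Finite.of_surjective g hg

/-- Over a local ring of depth zero, the cokernel of an injection of finite free modules is
free. -/
theorem free_of_exact_of_socle {B : Type*} [CommRing B] [IsLocalRing B] {c : B} (hc : c ≠ 0)
    (hcm : ∀ x ∈ maximalIdeal B, c * x = 0) {K F M : Type*} [AddCommGroup K] [Module B K]
    [AddCommGroup F] [Module B F] [AddCommGroup M] [Module B M] [Module.Free B K]
    [Module.Finite B K] [Module.Free B F] [Module.Finite B F] {i : K →ₗ[B] F} {p : F →ₗ[B] M}
    (hi : Injective i) (hip : Exact i p) (hp : Surjective p) : Module.Free B M := by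
  refine Module.free_of_lTensor_residueField_injective i p hp hip ?_
  rw [injective_iff_map_eq_zero]
  intro x hx
  obtain ⟨v, rfl⟩ := TensorProduct.mk_surjective B K (ResidueField B) Ideal.Quotient.mk_surjective x
  have kerF : ∀ y ∈ (maximalIdeal B • ⊤ : Submodule B F), c • y = 0 := by
    intro y hy
    refine Submodule.smul_induction_on hy (fun r hr n _ => ?_) fun a b ha hb => ?_
    · rw [smul_smul, hcm r hr, zero_smul]
    · rw [smul_add, ha, hb, add_zero]
  have h1 : i v ∈ (maximalIdeal B • ⊤ : Submodule B F) := by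
    rw [← LinearMap.ker_tensorProductMk, LinearMap.mem_ker]
    exact hx
  -- The socle element `c` kills 𝔪F, which contains `i v`; a unit coordinate of `v` would then force
  -- `c = 0`.
  have h2 : c • v = 0 := hi (by rw [map_smul, kerF _ h1, map_zero])
  have h3 : v ∈ (maximalIdeal B • ⊤ : Submodule B K) := by
    let b := Module.Free.chooseBasis B K
    rw [← b.sum_repr v]
    refine Submodule.sum_mem _ fun j _ => Submodule.smul_mem_smul ?_ trivial
    rw [IsLocalRing.mem_maximalIdeal, mem_nonunits_iff]
    intro hu
    have h4 : c * b.repr v j = 0 := by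
      have := congrArg (fun y => b.repr y j) h2
      simpa using this
    exact hc ((hu.mul_left_eq_zero).mp h4)
  rw [← LinearMap.ker_tensorProductMk, LinearMap.mem_ker] at h3
  exact h3

theorem finrank_add_finrank_of_exact {B : Type*} [CommRing B] [Nontrivial B]
    {K F M : Type*} [AddCommGroup K] [Module B K]
    [AddCommGroup F] [Module B F] [AddCommGroup M] [Module B M] [Module.Free B K]
    [Module.Finite B K] [Module.Free B M] [Module.Finite B M] {i : K →ₗ[B] F} {p : F →ₗ[B] M}
    (hi : Injective i) (hip : Exact i p) (hp : Surjective p) :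
    Module.finrank B F = Module.finrank B K + Module.finrank B M := by
  obtain ⟨l, hl⟩ := Module.projective_lifting_property p LinearMap.id hp
  have e := (hip.splitSurjectiveEquiv hi ⟨l, hl⟩).1
  rw [e.finrank_eq, Module.finrank_prod]

theorem exists_socle_of_mem_associatedPrimes {A : Type*} [CommRing A] [IsNoetherianRing A]
    {p : Ideal A} [p.IsPrime] (hp : p ∈ associatedPrimes A A) :
    ∃ c : Localization.AtPrime p, c ≠ 0 ∧
      ∀ x ∈ maximalIdeal (Localization.AtPrime p), c * x = 0 := by
  obtain ⟨-, a, ha⟩ := isAssociatedPrime_iff.mp hp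
  have hmem : ∀ r, r ∈ p ↔ r * a = 0 := by
    intro r
    rw [ha, Submodule.mem_colon_singleton, Submodule.mem_bot, smul_eq_mul]
  refine ⟨algebraMap A _ a, ?_, ?_⟩
  · intro h
    rw [IsLocalization.map_eq_zero_iff p.primeCompl] at h
    obtain ⟨m, hm⟩ := h
    exact m.2 ((hmem _).mpr hm)
  · intro x hx
    rw [← Localization.AtPrime.map_eq_maximalIdeal] at hx
    refine Submodule.span_induction ?_ (mul_zero _) ?_ ?_ hx
    · rintro _ ⟨r, hr, rfl⟩
      rw [← map_mul, mul_comm, (hmem r).mp hr, map_zero]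
    · intro x y _ _ hx hy
      rw [mul_add, hx, hy, add_zero]
    · intro r x _ hx
      rw [smul_eq_mul, mul_left_comm, hx, mul_zero]

/-- The local ring at an associated prime has a nonzero socle element, so every syzygy becomes free
there. Ranks add along the resolution, so the rank of `M` is an alternating sum of the ranks in the
resolution and does not depend on `p`. -/
theorem FinFreeRes.exists_rank {A : Type u} [CommRing A] [IsNoetherianRing A] {n : ℕ} {M : Type u}
    [AddCommGroup M] [Module A M] (h : FinFreeRes A n M) :
    ∃ χ : ℤ, ∀ (p : Ideal A) [p.IsPrime], p ∈ associatedPrimes A A →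
      Module.Free (Localization.AtPrime p) (LocalizedModule p.primeCompl M) ∧
      (Module.finrank (Localization.AtPrime p) (LocalizedModule p.primeCompl M) : ℤ) = χ := by
  induction n generalizing M with
  | zero =>
    obtain ⟨h1, h2⟩ := h
    refine ⟨Module.finrank A M, fun p _ hp => ?_⟩
    refine ⟨Module.free_of_isLocalizedModule p.primeCompl
      (LocalizedModule.mkLinearMap p.primeCompl M), ?_⟩
    rw [Module.finrank_of_isLocalizedModule_of_free (Localization.AtPrime p) p.primeCompl
      (LocalizedModule.mkLinearMap p.primeCompl M)]
  | succ n ih =>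
    obtain ⟨r, g, hg, h⟩ := h
    obtain ⟨χ, hχ⟩ := ih h
    refine ⟨r - χ, fun p _ hp => ?_⟩
    obtain ⟨h1, h2⟩ := hχ p hp
    obtain ⟨c, hc, hcm⟩ := exists_socle_of_mem_associatedPrimes hp
    let S := p.primeCompl
    have hi : Injective (LocalizedModule.map S (LinearMap.ker g).subtype) :=
      LocalizedModule.map_injective S _ (Submodule.injective_subtype _)
    have hip : Exact (LocalizedModule.map S (LinearMap.ker g).subtype)
        (LocalizedModule.map S g) :=
      LocalizedModule.map_exact S _ _ (LinearMap.exact_subtype_ker_map g)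
    have hp' : Surjective (LocalizedModule.map S g) := LocalizedModule.map_surjective S g hg
    have := h.finite
    have f1 : Module.Free (Localization S) (LocalizedModule S (Fin r → A)) :=
      Module.free_of_isLocalizedModule S (LocalizedModule.mkLinearMap S (Fin r → A))
    have f2 : Module.Finite (Localization S) (LocalizedModule S (LinearMap.ker g)) :=
      Module.Finite.of_isLocalizedModule S (LocalizedModule.mkLinearMap S (LinearMap.ker g))
    have f3 : Module.Finite (Localization S) (LocalizedModule S (Fin r → A)) :=
      Module.Finite.of_isLocalizedModule S (LocalizedModule.mkLinearMap S (Fin r → A))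
    have f4 : Module.Free (Localization S) (LocalizedModule S M) :=
      free_of_exact_of_socle (B := Localization.AtPrime p)
        (K := LocalizedModule S (LinearMap.ker g)) hc hcm hi hip hp'
    have f5 : Module.Finite (Localization S) (LocalizedModule S M) :=
      Module.Finite.of_surjective _ hp'
    refine ⟨f4, ?_⟩
    have h3 := finrank_add_finrank_of_exact (B := Localization.AtPrime p)
      (K := LocalizedModule S (LinearMap.ker g)) hi hip hp'
    have h4 : Module.finrank (Localization S) (LocalizedModule S (Fin r → A)) = r := by
      have := Localization.AtPrime.isLocalRing p
      have : Nontrivial A := (algebraMap A (Localization.AtPrime p)).domain_nontrivial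
      rw [Module.finrank_of_isLocalizedModule_of_free (Localization S) S
        (LocalizedModule.mkLinearMap S (Fin r → A))]
      simp
    rw [← h2]
    have h5 : (r : ℤ) = _ := congrArg Nat.cast (h4.symm.trans h3)
    rw [h5]
    push_cast
    ring

/-- A nonzero ideal with a finite free resolution of its quotient is not contained in any
associated prime. -/
theorem FinFreeRes.ideal_eq_bot_or {A : Type u} [CommRing A] [IsNoetherianRing A] {n : ℕ}
    {J : Ideal A} {M : Type u} [AddCommGroup M] [Module A M] (e : (A ⧸ J) ≃ₗ[A] M)
    (h : FinFreeRes A n M) :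
    J = ⊥ ∨ ∀ p ∈ associatedPrimes A A, ¬ J ≤ p := by
  obtain ⟨χ, hχ⟩ := h.exists_rank
  have hfin := h.finite
  have key : ∀ (p : Ideal A) [p.IsPrime], p ∈ associatedPrimes A A →
      (J ≤ p ↔ Nontrivial (LocalizedModule p.primeCompl M)) := by
    intro p _ hp
    rw [← not_subsingleton_iff_nontrivial, LocalizedModule.subsingleton_iff]
    constructor
    · intro hJ hM
      obtain ⟨s, hs, hs'⟩ := hM (e 1)
      rw [← map_smul, e.map_eq_zero_iff] at hs'
      have h1 : s • (1 : A ⧸ J) = Ideal.Quotient.mk J s := by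
        rw [← map_one (Ideal.Quotient.mk J), ← Ideal.Quotient.mk_eq_mk,
          ← Submodule.Quotient.mk_smul,
          smul_eq_mul, mul_one]
        rfl
      rw [h1, Ideal.Quotient.eq_zero_iff_mem] at hs'
      exact hs (hJ hs')
    · intro hM j hj
      by_contra hjp
      refine hM fun m => ⟨j, hjp, ?_⟩
      obtain ⟨y, rfl⟩ := e.surjective m
      obtain ⟨a, rfl⟩ := Ideal.Quotient.mk_surjective y
      rw [← map_smul, e.map_eq_zero_iff, ← Ideal.Quotient.mk_eq_mk, ← Submodule.Quotient.mk_smul,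
        Submodule.Quotient.mk_eq_zero]
      exact J.mul_mem_right _ hj
  -- The common rank `χ` decides for all associated primes at once: either all of them contain `J`
  -- or none does.
  have key2 : ∀ (p : Ideal A) [p.IsPrime], p ∈ associatedPrimes A A → (J ≤ p ↔ χ ≠ 0) := by
    intro p _ hp
    obtain ⟨h1, h2⟩ := hχ p hp
    have f5 : Module.Finite (Localization p.primeCompl) (LocalizedModule p.primeCompl M) :=
      Module.Finite.of_isLocalizedModule p.primeCompl (LocalizedModule.mkLinearMap p.primeCompl M)
    rw [key p hp, ← h2, Nat.cast_ne_zero, ← Nat.pos_iff_ne_zero]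
    exact (Module.finrank_pos_iff_of_free (Localization.AtPrime p) _).symm
  by_cases hχ0 : χ = 0
  · right
    intro p hp hJp
    have := hp.isPrime
    exact (key2 p hp).mp hJp hχ0
  · left
    rw [eq_bot_iff]
    intro j hj
    by_contra hj0
    -- Choose `p` containing the annihilator of `j`. Then `(A/J)_p` is free, nonzero and killed by
    -- `j`, so `j` vanishes in `A_p`, against the choice of `p`.
    obtain ⟨p, hp, hjp⟩ := exists_le_isAssociatedPrime_of_isNoetherianRing A j hj0
    have hprime := hp.isPrime
    have hnt := (key p hp).mp ((key2 p hp).mpr hχ0)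
    obtain ⟨h1, -⟩ := hχ p hp
    have h0 : ∀ y : LocalizedModule p.primeCompl M,
        algebraMap A (Localization.AtPrime p) j • y = 0 := by
      intro y
      induction y using LocalizedModule.induction_on with
      | _ m s =>
        rw [algebraMap_smul, LocalizedModule.smul'_mk]
        have : j • m = 0 := by
          obtain ⟨y, rfl⟩ := e.surjective m
          obtain ⟨a, rfl⟩ := Ideal.Quotient.mk_surjective y
          rw [← map_smul, e.map_eq_zero_iff, ← Ideal.Quotient.mk_eq_mk,
            ← Submodule.Quotient.mk_smul, Submodule.Quotient.mk_eq_zero]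
          exact J.mul_mem_right _ hj
        rw [this, LocalizedModule.zero_mk]
    have h2 : algebraMap A (Localization.AtPrime p) j = 0 := by
      let b := Module.Free.chooseBasis (Localization.AtPrime p) (LocalizedModule p.primeCompl M)
      obtain ⟨i⟩ := b.index_nonempty
      have := congrArg (fun y => b.repr y i) (h0 (b i))
      simpa [-algebraMap_smul] using this
    rw [IsLocalization.map_eq_zero_iff p.primeCompl] at h2
    obtain ⟨m, hm⟩ := h2
    exact m.2 (hjp (by rw [Submodule.mem_colon_singleton, Submodule.mem_bot, smul_eq_mul, hm]))

end FiniteFreeResolution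

/-! ### Nagata's reduction modulo a regular element outside 𝔪². -/

section HypersurfaceReduction

theorem exists_linearMap_eq_one_of_notMem_sq {A : Type*} [CommRing A] [IsLocalRing A] {f : A}
    (hf : f ∈ maximalIdeal A) (hf2 : f ∉ maximalIdeal A ^ 2) :
    ∃ l : maximalIdeal A →ₗ[A] ResidueField A, l ⟨f, hf⟩ = 1 := by
  have hne : (maximalIdeal A).toCotangent ⟨f, hf⟩ ≠ 0 := by
    rwa [ne_eq, Ideal.toCotangent_eq_zero]
  obtain ⟨φ, hφ⟩ : ∃ φ : Module.Dual (ResidueField A) (CotangentSpace A),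
      φ ((maximalIdeal A).toCotangent ⟨f, hf⟩) ≠ 0 := by
    by_contra! h
    exact hne ((Module.forall_dual_apply_eq_zero_iff (ResidueField A) _).mp h)
  let ψ : CotangentSpace A →ₗ[ResidueField A] ResidueField A :=
    (φ ((maximalIdeal A).toCotangent ⟨f, hf⟩))⁻¹ • φ
  refine ⟨(ψ.restrictScalars A) ∘ₗ (maximalIdeal A).toCotangent, ?_⟩
  change (φ ((maximalIdeal A).toCotangent ⟨f, hf⟩))⁻¹ *
    φ ((maximalIdeal A).toCotangent ⟨f, hf⟩) = 1
  exact inv_mul_cancel₀ hφ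

/-- Multiplication by `f` on `A^r` resolves `(A/f)^r`, so Tor₁ is the `f`-torsion of `N^r`. -/
theorem torOneZero_pi_quotient {A : Type*} [CommRing A] {f : A} (hf : IsSMulRegular A f) (r : ℕ)
    {N : Type*} [AddCommGroup N] [Module A N] (hN : IsSMulRegular N f) :
    TorOneZero A (Fin r → A ⧸ Ideal.span {f}) N := by
  let i : (Fin r → A) →ₗ[A] (Fin r → A) := f • LinearMap.id
  let p : (Fin r → A) →ₗ[A] (Fin r → A ⧸ Ideal.span {f}) :=
    (Submodule.mkQ (Ideal.span {f})).compLeft (Fin r)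
  have hi : Injective i := fun x y h => funext fun j => hf (congrFun h j)
  have hp : Surjective p := (Submodule.mkQ_surjective (Ideal.span {f})).comp_left
  have hip : Exact i p := by
    intro x
    constructor
    · intro hx
      have hx' : ∀ j, ∃ a, a * f = x j := fun j => by
        rw [← Ideal.mem_span_singleton', ← Ideal.Quotient.eq_zero_iff_mem]
        exact congrFun hx j
      choose a ha using hx'
      exact ⟨a, funext fun j => by simp [i, ← ha, mul_comm]⟩
    · rintro ⟨a, rfl⟩
      refine funext fun j => ?_
      change Ideal.Quotient.mk (Ideal.span {f}) (f * a j) = 0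
      rw [Ideal.Quotient.eq_zero_iff_mem]
      exact Ideal.mul_mem_right _ _ (Ideal.mem_span_singleton_self f)
  rw [torOneZero_iff_of_left hi hip hp N (TorOneZero.of_flat _ N)]
  have h1 : i.rTensor N = (f • LinearMap.id : N →ₗ[A] N).lTensor (Fin r → A) := by
    ext; simp [i]
  rw [h1]
  exact Module.Flat.lTensor_preserves_injective_linearMap _ hN

theorem torZero_pi_quotient {A : Type u} [CommRing A] {f : A} (hf : IsSMulRegular A f) (r : ℕ)
    (j : ℕ) {N : Type u} [AddCommGroup N] [Module A N] (hN : IsSMulRegular N f) :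
    TorZero A (Fin r → A ⧸ Ideal.span {f}) j N := by
  induction j generalizing N with
  | zero => exact torOneZero_pi_quotient hf r hN
  | succ j ih =>
    refine ih fun x y h => Subtype.ext (Finsupp.ext fun n => hf ?_)
    exact congrArg (fun z : Syz A N => (z : N →₀ A) n) h

variable {A : Type u} [CommRing A] [IsLocalRing A] [IsNoetherianRing A] {f : A}

/-- Let `K = ker g`. Vanishing of Tor₁(M, 𝔪) makes `K ⊗ 𝔪 → (A/f)^r ⊗ 𝔪` injective. If the entries
of `v ∈ K` lift to `a j ∈ 𝔪`, then `v ⊗ f` maps to `∑ e_j ⊗ a_j f = ∑ f e_j ⊗ a_j = 0`, so `v ⊗ f =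
0`. A functional on 𝔪 sending `f` to 1, which exists because `f ∉ 𝔪²`, gives `v ∈ 𝔪K`. So `K` stays
injective modulo the maximal ideal, and `M` is free over `A/f`. -/
theorem free_quotient_of_torOneZero (hf : IsSMulRegular A f) (hfm : f ∈ maximalIdeal A)
    (hf2 : f ∉ maximalIdeal A ^ 2) [IsLocalRing (A ⧸ Ideal.span {f})] (M : Type*)
    [AddCommGroup M] [Module A M] [Module (A ⧸ Ideal.span {f}) M]
    [IsScalarTower A (A ⧸ Ideal.span {f}) M] {r : ℕ}
    {g : (Fin r → A ⧸ Ideal.span {f}) →ₗ[A ⧸ Ideal.span {f}] M} (hg : Surjective g)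
    (h : TorOneZero A M (maximalIdeal A)) : Module.Free (A ⧸ Ideal.span {f}) M := by
  have hN : IsSMulRegular (maximalIdeal A) f := fun x y h =>
    Subtype.ext (hf (congrArg Subtype.val h))
  have htor := torOneZero_pi_quotient hf r hN
  let i := (LinearMap.ker g).subtype
  have hi : Injective i := Submodule.injective_subtype _
  have hip : Exact i g := LinearMap.exact_subtype_ker_map g
  have key : Injective ((i.restrictScalars A).rTensor (maximalIdeal A)) := by
    rw [← torOneZero_iff_of_left (p := g.restrictScalars A) hi hip hg _ htor]
    exact h
  obtain ⟨l, hl⟩ := exists_linearMap_eq_one_of_notMem_sq hfm hf2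
  have hmax : (maximalIdeal A).map (Ideal.Quotient.mk (Ideal.span {f})) =
      maximalIdeal (A ⧸ Ideal.span {f}) :=
    IsLocalRing.map_maximalIdeal_of_surjective _ Ideal.Quotient.mk_surjective
  refine Module.free_of_lTensor_residueField_injective i g hg hip ?_
  rw [injective_iff_map_eq_zero]
  intro x hx
  obtain ⟨v, rfl⟩ := TensorProduct.mk_surjective (A ⧸ Ideal.span {f}) (LinearMap.ker g)
    (ResidueField (A ⧸ Ideal.span {f})) Ideal.Quotient.mk_surjective x
  have h1 : i v ∈ (maximalIdeal (A ⧸ Ideal.span {f}) • ⊤ :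
      Submodule (A ⧸ Ideal.span {f}) (Fin r → A ⧸ Ideal.span {f})) := by
    rw [← LinearMap.ker_tensorProductMk, LinearMap.mem_ker]
    exact hx
  have h2 : ∀ j, i v j ∈ maximalIdeal (A ⧸ Ideal.span {f}) := by
    intro j
    refine Submodule.smul_induction_on h1 (fun a ha n _ => ?_) fun a b ha hb => ?_
    · exact Ideal.mul_mem_right _ _ ha
    · exact Ideal.add_mem _ ha hb
  have h3 : ∀ j, ∃ a ∈ maximalIdeal A, Ideal.Quotient.mk (Ideal.span {f}) a = i v j := by
    intro j
    have := h2 j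
    rw [← hmax, Ideal.mem_map_iff_of_surjective _ Ideal.Quotient.mk_surjective] at this
    exact this
  choose a ha ha' using h3
  have h4 : v ⊗ₜ[A] (⟨f, hfm⟩ : maximalIdeal A) = 0 := by
    apply key
    rw [map_zero, LinearMap.rTensor_tmul]
    change (i v) ⊗ₜ[A] (⟨f, hfm⟩ : maximalIdeal A) = 0
    have h5 : i v = ∑ j, a j • (Pi.single j 1 : Fin r → A ⧸ Ideal.span {f}) := by
      funext k
      rw [Finset.sum_apply, Finset.sum_eq_single k]
      · rw [Pi.smul_apply, Pi.single_eq_same, ← ha' k, Algebra.smul_def, mul_one]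
        rfl
      · intro b _ hb
        rw [Pi.smul_apply, Pi.single_eq_of_ne hb.symm, smul_zero]
      · simp
    rw [h5, TensorProduct.sum_tmul]
    refine Finset.sum_eq_zero fun j _ => ?_
    have h6 : a j • (⟨f, hfm⟩ : maximalIdeal A) = f • (⟨a j, ha j⟩ : maximalIdeal A) :=
      Subtype.ext (mul_comm _ _)
    rw [TensorProduct.smul_tmul, h6, ← TensorProduct.smul_tmul]
    have h7 : f • (Pi.single j 1 : Fin r → A ⧸ Ideal.span {f}) = 0 := by
      rw [← Pi.single_smul, Algebra.smul_def, mul_one]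
      have : algebraMap A (A ⧸ Ideal.span {f}) f = 0 :=
        Ideal.Quotient.eq_zero_iff_mem.mpr (Ideal.mem_span_singleton_self f)
      rw [this, Pi.single_zero]
    rw [h7, TensorProduct.zero_tmul]
  have h5 : (1 : ResidueField A) ⊗ₜ[A] v = 0 := by
    have := congrArg (fun z => TensorProduct.comm A _ _ (l.lTensor (LinearMap.ker g) z)) h4
    simpa [hl] using this
  have h6 : v ∈ (maximalIdeal A • ⊤ : Submodule A (LinearMap.ker g)) := by
    rw [← LinearMap.ker_tensorProductMk, LinearMap.mem_ker]
    exact h5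
  have h7 : v ∈ (maximalIdeal (A ⧸ Ideal.span {f}) • ⊤ :
      Submodule (A ⧸ Ideal.span {f}) (LinearMap.ker g)) := by
    refine Submodule.smul_induction_on h6 (fun a ha n _ => ?_) fun a b ha hb => ?_
    · rw [← algebraMap_smul (A ⧸ Ideal.span {f}) a n]
      refine Submodule.smul_mem_smul ?_ trivial
      rw [← hmax]
      exact Ideal.mem_map_of_mem _ ha
    · exact Submodule.add_mem _ ha hb
  rw [← LinearMap.ker_tensorProductMk, LinearMap.mem_ker] at h7
  exact h7

/-- Nagata: passing to the quotient by a regular element outside the square of the maximal ideal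
preserves finite free resolutions. -/
theorem finFreeRes_quotient (hf : IsSMulRegular A f) (hfm : f ∈ maximalIdeal A)
    (hf2 : f ∉ maximalIdeal A ^ 2) [IsLocalRing (A ⧸ Ideal.span {f})] (n : ℕ) (M : Type u)
    [AddCommGroup M] [Module A M] [Module (A ⧸ Ideal.span {f}) M]
    [IsScalarTower A (A ⧸ Ideal.span {f}) M] [Module.Finite (A ⧸ Ideal.span {f}) M]
    (h : TorZero A M n (maximalIdeal A)) : FinFreeRes (A ⧸ Ideal.span {f}) n M := by
  induction n generalizing M with
  | zero =>
    obtain ⟨r, g, hg⟩ := Module.Finite.exists_fin' (A ⧸ Ideal.span {f}) M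
    exact ⟨free_quotient_of_torOneZero hf hfm hf2 M hg h, inferInstance⟩
  | succ n ih =>
    obtain ⟨r, g, hg⟩ := Module.Finite.exists_fin' (A ⧸ Ideal.span {f}) M
    refine ⟨r, g, hg, ih _ ?_⟩
    have hN : IsSMulRegular (maximalIdeal A) f := fun x y h =>
      Subtype.ext (hf (congrArg Subtype.val h))
    exact (torZero_succ_iff (K := LinearMap.ker g)
      (i := (LinearMap.ker g).subtype.restrictScalars A)
      (p := g.restrictScalars A) (Submodule.injective_subtype _)
      (LinearMap.exact_subtype_ker_map g) hg n (maximalIdeal A)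
      fun j => torZero_pi_quotient hf r j hN).mp h

end HypersurfaceReduction

/-! ### The inequality for surjective maps. -/

section SurjectiveCase

theorem embDim_le_card {A : Type*} [CommRing A] [IsLocalRing A] (T : Finset A)
    (h : maximalIdeal A = Ideal.span (T : Set A)) : embDim A ≤ T.card := by
  rw [embDim, h, ← Set.ncard_coe_finset]
  exact Submodule.spanFinrank_span_le_ncard_of_finite T.finite_toSet

theorem exists_finset_card_eq_embDim (A : Type*) [CommRing A] [IsLocalRing A]
    [IsNoetherianRing A] :
    ∃ T : Finset A, T.card = embDim A ∧ Ideal.span (T : Set A) = maximalIdeal A :=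
  Submodule.FG.exists_span_finset_card_eq_spanFinrank (maximalIdeal A).fg_of_isNoetherianRing

theorem exists_finset_lift_maximalIdeal {A S : Type*} [CommRing A] [IsLocalRing A] [CommRing S]
    [IsLocalRing S] [IsNoetherianRing S] {φ : A →+* S} (hφ : Surjective φ) :
    ∃ T : Finset A, T.card ≤ embDim S ∧ (T : Set A) ⊆ maximalIdeal A ∧
      maximalIdeal A = Ideal.span (T : Set A) ⊔ RingHom.ker φ := by
  classical
  obtain ⟨T, hT, hT'⟩ := exists_finset_card_eq_embDim S
  have hmax : (maximalIdeal S).comap φ = maximalIdeal A :=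
    have := hφ.isLocalHom
    maximalIdeal_comap φ
  choose g hg using hφ
  have him : φ '' ((T.image g : Finset A) : Set A) = T := by
    rw [Finset.coe_image, ← Set.image_comp]
    have : φ ∘ g = id := funext hg
    rw [this, Set.image_id]
  refine ⟨T.image g, Finset.card_image_le.trans hT.le, ?_, ?_⟩
  · intro x hx
    have h1 : φ x ∈ (T : Set S) := him ▸ Set.mem_image_of_mem φ hx
    change x ∈ maximalIdeal A
    rw [← hmax, Ideal.mem_comap, ← hT']
    exact Ideal.subset_span h1
  · rw [← hmax, ← hT', ← him, ← Ideal.map_span, Ideal.comap_map_of_surjective' φ fun x => ⟨_, hg x⟩]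

theorem embDim_le_succ_of_ker_eq_span {A S : Type*} [CommRing A] [IsLocalRing A] [CommRing S]
    [IsLocalRing S] [IsNoetherianRing S] {φ : A →+* S} (hφ : Surjective φ) {f : A}
    (hf : RingHom.ker φ = Ideal.span {f}) : embDim A ≤ embDim S + 1 := by
  classical
  obtain ⟨T, hT, -, h⟩ := exists_finset_lift_maximalIdeal hφ
  rw [hf, ← Ideal.span_union, Set.union_singleton, ← Finset.coe_insert] at h
  exact (embDim_le_card _ h).trans ((Finset.card_insert_le _ _).trans (by omega))

/-- Lifted generators of the maximal ideal of `S` generate that of `A` modulo its square, hence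
generate it by Nakayama. -/
theorem embDim_le_of_ker_le_sq {A S : Type*} [CommRing A] [IsLocalRing A] [IsNoetherianRing A]
    [CommRing S] [IsLocalRing S] [IsNoetherianRing S] {φ : A →+* S} (hφ : Surjective φ)
    (h : RingHom.ker φ ≤ maximalIdeal A ^ 2) : embDim A ≤ embDim S := by
  obtain ⟨T, hT, hTm, h'⟩ := exists_finset_lift_maximalIdeal hφ
  refine (embDim_le_card T (le_antisymm ?_ (Ideal.span_le.mpr hTm))).trans hT
  refine Submodule.le_of_le_smul_of_le_jacobson_bot (I := maximalIdeal A)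
    (maximalIdeal A).fg_of_isNoetherianRing (maximalIdeal_le_jacobson _) ?_
  rw [smul_eq_mul, ← sq]
  exact h'.le.trans (sup_le_sup_left h _)

theorem exists_mem_nonZeroDivisors_notMem_sq {A : Type*} [CommRing A] [IsLocalRing A]
    [IsNoetherianRing A] {J : Ideal A} (h : ∀ p ∈ associatedPrimes A A, ¬ J ≤ p)
    (h2 : ¬ J ≤ maximalIdeal A ^ 2) :
    ∃ f ∈ J, f ∈ nonZeroDivisors A ∧ f ∉ maximalIdeal A ^ 2 := by
  classical
  by_contra! hcon
  let s : Finset (Ideal A) := insert (maximalIdeal A ^ 2) (associatedPrimes.finite A A).toFinset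
  have hsub : (J : Set A) ⊆ ⋃ I ∈ (s : Set (Ideal A)), ((id I : Ideal A) : Set A) := by
    intro x hx
    by_cases hx' : x ∈ nonZeroDivisors A
    · exact Set.mem_biUnion (x := maximalIdeal A ^ 2) (by simp [s]) (hcon x hx hx')
    · have : x ∈ (nonZeroDivisors A : Set A)ᶜ := hx'
      rw [← biUnion_associatedPrimes_eq_compl_nonZeroDivisors] at this
      obtain ⟨p, hp, hxp⟩ := Set.mem_iUnion₂.mp this
      exact Set.mem_biUnion (x := p) (by simp [s, hp]) hxp
  -- Prime avoidance tolerates two non-prime ideals; 𝔪² fills both places.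
  rw [Ideal.subset_union_prime (maximalIdeal A ^ 2) (maximalIdeal A ^ 2)] at hsub
  · obtain ⟨I, hI, hJI⟩ := hsub
    rcases Finset.mem_insert.mp hI with rfl | hI
    · exact h2 hJI
    · exact h I (by simpa using hI) hJI
  · intro I hI hne _
    rcases Finset.mem_insert.mp hI with rfl | hI
    · exact absurd rfl hne
    · have : I ∈ associatedPrimes A A := by simpa using hI
      exact this.isPrime

/-- Induction on `r`, a lower bound for the excess of edim A over edim S. A positive excess keeps
the kernel out of 𝔪², which supplies an `f` to divide by, and `A/f` still maps onto the same `S`. -/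
theorem ringKrullDim_add_le_of_surjective (r : ℕ) {A S : Type u} [CommRing A] [IsLocalRing A]
    [IsNoetherianRing A] [CommRing S] [IsLocalRing S] [IsNoetherianRing S] [Algebra A S]
    (hsurj : Surjective (algebraMap A S)) {n : ℕ} (hres : FinFreeRes A n S)
    (hr : embDim S + r ≤ embDim A) : ringKrullDim S + r ≤ ringKrullDim A := by
  induction r generalizing A with
  | zero =>
    rw [Nat.cast_zero, add_zero]
    exact ringKrullDim_le_of_surjective _ hsurj
  | succ r ih =>
    let J := RingHom.ker (algebraMap A S)
    have hJ2 : ¬ J ≤ maximalIdeal A ^ 2 := fun h => by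
      have := embDim_le_of_ker_le_sq hsurj h
      omega
    have hass : ∀ p ∈ associatedPrimes A A, ¬ J ≤ p := by
      let e : (A ⧸ J) ≃ₗ[A] S :=
        ((Algebra.linearMap A S).quotKerEquivOfSurjective hsurj)
      exact (hres.ideal_eq_bot_or e).resolve_left fun h => hJ2 (h ▸ bot_le)
    obtain ⟨f, hfJ, hf, hf2⟩ := exists_mem_nonZeroDivisors_notMem_sq hass hJ2
    have hfm : f ∈ maximalIdeal A := le_maximalIdeal (RingHom.ker_ne_top _) hfJ
    have hlif : ∀ a ∈ Ideal.span {f}, algebraMap A S a = 0 := by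
      intro a ha
      exact (Ideal.span_singleton_le_iff_mem J).mpr hfJ ha
    let _ : Algebra (A ⧸ Ideal.span {f}) S :=
      (Ideal.Quotient.lift (Ideal.span {f}) (algebraMap A S) hlif).toAlgebra
    have : IsScalarTower A (A ⧸ Ideal.span {f}) S := IsScalarTower.of_algebraMap_eq fun a => rfl
    have hsurj' : Surjective (algebraMap (A ⧸ Ideal.span {f}) S) :=
      Ideal.Quotient.lift_surjective_of_surjective _ hlif hsurj
    have : Nontrivial (A ⧸ Ideal.span {f}) :=
      Ideal.Quotient.nontrivial_iff.mpr fun h => by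
        have := (Ideal.span_singleton_le_iff_mem _).mpr hfm
        rw [h, top_le_iff] at this
        exact Ideal.IsPrime.ne_top' this
    have : IsLocalRing (A ⧸ Ideal.span {f}) :=
      IsLocalRing.of_surjective' (Ideal.Quotient.mk _) Ideal.Quotient.mk_surjective
    have hreg : IsSMulRegular A f := Module.Flat.isSMulRegular_of_nonZeroDivisors hf
    have : Module.Finite (A ⧸ Ideal.span {f}) S :=
      Module.Finite.of_surjective (Algebra.linearMap _ S) hsurj'
    have hres' : FinFreeRes (A ⧸ Ideal.span {f}) n S :=
      finFreeRes_quotient hreg hfm hf2 n S (hres.flatDimLE _)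
    have hemb : embDim A ≤ embDim (A ⧸ Ideal.span {f}) + 1 :=
      embDim_le_succ_of_ker_eq_span (φ := Ideal.Quotient.mk (Ideal.span {f}))
        Ideal.Quotient.mk_surjective Ideal.mk_ker
    have h1 := ih hsurj' hres' (by omega)
    have h2 := ringKrullDim_quotient_succ_le_of_nonZeroDivisor hf
    rw [Nat.cast_succ, ← add_assoc]
    exact (add_le_add_left h1 1).trans h2

theorem embDim_sub_dimNat_le_of_surjective {A S : Type u} [CommRing A] [IsLocalRing A]
    [IsNoetherianRing A] [CommRing S] [IsLocalRing S] [IsNoetherianRing S] [Algebra A S]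
    (hsurj : Surjective (algebraMap A S)) {n : ℕ} (hres : FinFreeRes A n S) :
    (embDim A : ℤ) - dimNat A ≤ embDim S - dimNat S := by
  rcases le_total (embDim S) (embDim A) with h | h
  · obtain ⟨r, hr⟩ := Nat.exists_eq_add_of_le h
    have h1 := ringKrullDim_add_le_of_surjective r hsurj hres hr.ge
    rw [← coe_dimNat, ← coe_dimNat] at h1
    have h2 : dimNat S + r ≤ dimNat A := by exact_mod_cast h1
    omega
  -- With no excess of edim A over edim S, the inequality dim S ≤ dim A suffices.
  · have h1 := ringKrullDim_le_of_surjective _ hsurj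
    rw [← coe_dimNat, ← coe_dimNat] at h1
    have h2 : dimNat S ≤ dimNat A := by exact_mod_cast h1
    omega

end SurjectiveCase

/-! ### Flat extensions `R → A` in which `q` generates the maximal ideal. -/

section UnramifiedFlat

/-- The elements `z i` of `q` are linearly independent modulo `q ^ 2`. -/
def CotangentIndep {R : Type*} [CommRing R] (q : Ideal R) {g : ℕ} (z : Fin g → R) : Prop :=
  (∀ i, z i ∈ q) ∧ ∀ r : Fin g → R, ∑ i, r i * z i ∈ q ^ 2 → ∀ i, r i ∈ q

/-- The kernel of `r ↦ ∑ r i * z i` modulo `q ^ 2` has all entries in `q`. By flatness the kernel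
over `A` is generated by the image of this one. -/
theorem CotangentIndep.mem_map_of_flat {R : Type v} {A : Type u} [CommRing R] [CommRing A]
    [Algebra R A] [Module.Flat R A] {q : Ideal R} {g : ℕ} {z : Fin g → R}
    (hz : CotangentIndep q z) {c : Fin g → A}
    (hc : ∑ i, c i * algebraMap R A (z i) ∈ (q ^ 2).map (algebraMap R A)) (i : Fin g) :
    c i ∈ q.map (algebraMap R A) := by
  classical
  let l : (Fin g → R) →ₗ[R] R ⧸ q ^ 2 := (Submodule.mkQ (q ^ 2)) ∘ₗ Fintype.linearCombination R z
  have hl : ∀ r, r ∈ LinearMap.ker l → ∀ i, r i ∈ q := by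
    intro r hr
    apply hz.2 r
    rw [← Ideal.Quotient.eq_zero_iff_mem]
    exact hr
  have hex := Module.Flat.lTensor_exact A (LinearMap.exact_subtype_ker_map l)
  let x : A ⊗[R] (Fin g → R) := ∑ i, c i ⊗ₜ Pi.single i 1
  have hx : l.lTensor A x = 0 := by
    apply (TensorProduct.tensorQuotEquivQuotSMul A (q ^ 2)).injective
    rw [map_zero, map_sum, map_sum]
    have h1 : ∀ i, TensorProduct.tensorQuotEquivQuotSMul A (q ^ 2)
        (l.lTensor A (c i ⊗ₜ Pi.single i 1)) =
        Submodule.Quotient.mk (c i * algebraMap R A (z i)) := by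
      intro i
      have h2 : l (Pi.single i 1) = Ideal.Quotient.mk (q ^ 2) (z i) := by
        simp [l, Fintype.linearCombination_apply_single]
      rw [LinearMap.lTensor_tmul, h2, TensorProduct.tensorQuotEquivQuotSMul_tmul_mk]
      congr 1
      rw [Algebra.smul_def, mul_comm]
    rw [Finset.sum_congr rfl fun i _ => h1 i]
    change ∑ i, Submodule.mkQ _ _ = _
    rw [← map_sum, Submodule.mkQ_apply, Submodule.Quotient.mk_eq_zero, Ideal.smul_top_eq_map]
    exact hc
  obtain ⟨y, hy⟩ := (hex x).mp hx
  have hproj : ∀ y, TensorProduct.rid R A ((LinearMap.proj i : (Fin g → R) →ₗ[R] R).lTensor A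
      ((LinearMap.ker l).subtype.lTensor A y)) ∈ q.map (algebraMap R A) := by
    intro y
    induction y with
    | zero => simp
    | add a b ha hb => simp only [map_add]; exact Ideal.add_mem _ ha hb
    | tmul a b =>
      rw [LinearMap.lTensor_tmul, LinearMap.lTensor_tmul, TensorProduct.rid_tmul, Algebra.smul_def]
      exact Ideal.mul_mem_right _ _ (Ideal.mem_map_of_mem _ (hl b b.2 i))
  have h3 := hproj y
  rw [hy] at h3
  have h4 : TensorProduct.rid R A ((LinearMap.proj i : (Fin g → R) →ₗ[R] R).lTensor A x) = c i := by
    rw [map_sum, map_sum, Finset.sum_eq_single i]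
    · simp
    · intro b _ hb
      simp [Pi.single_eq_of_ne hb.symm]
    · simp
  rwa [h4] at h3

variable {R : Type v} {A : Type u} [CommRing R] [CommRing A] [IsLocalRing A] [IsNoetherianRing A]
  [Algebra R A] {q : Ideal R}

/-- Since `qA = 𝔪`, the map `q ⊗_R M → 𝔪 ⊗_A M` is onto. Flatness over `R` makes its composite with
`𝔪 ⊗_A M → M` injective, so the latter map is injective, which is the local criterion for freeness.
-/
theorem free_of_flat_of_map_eq_maximalIdeal (hq : q.map (algebraMap R A) = maximalIdeal A)
    (M : Type*) [AddCommGroup M] [Module A M] [Module R M] [IsScalarTower R A M]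
    [Module.Finite A M] [Module.Flat R M] : Module.Free A M := by
  have := Module.finitePresentation_of_finite A M
  refine Module.free_of_maximalIdeal_rTensor_injective ?_
  let a : q → maximalIdeal A := fun x => ⟨algebraMap R A x, hq ▸ Ideal.mem_map_of_mem _ x.2⟩
  let φ : q ⊗[R] M →+ maximalIdeal A ⊗[A] M := TensorProduct.liftAddHom
    { toFun := fun x =>
        { toFun := fun m => a x ⊗ₜ m
          map_zero' := TensorProduct.tmul_zero _ _
          map_add' := fun m n => TensorProduct.tmul_add _ _ _ }
      map_zero' := by
        ext m
        have : a 0 = 0 := Subtype.ext (map_zero _)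
        simp [this]
      map_add' := fun x y => by
        ext m
        have : a (x + y) = a x + a y := Subtype.ext (map_add _ _ _)
        simp [this, TensorProduct.add_tmul] }
    (by
      intro r x m
      change a (r • x) ⊗ₜ[A] m = a x ⊗ₜ[A] (r • m)
      have : a (r • x) = algebraMap R A r • a x := Subtype.ext (by simp [a, Algebra.smul_def])
      rw [this, TensorProduct.smul_tmul, algebraMap_smul])
  have hφ : ∀ (x : q) (m : M), φ (x ⊗ₜ m) = a x ⊗ₜ m := fun x m => rfl
  have hsurj : Surjective φ := by
    intro z
    induction z with
    | zero => exact ⟨0, map_zero _⟩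
    | add x y hx hy =>
      obtain ⟨x, rfl⟩ := hx
      obtain ⟨y, rfl⟩ := hy
      exact ⟨x + y, map_add _ _ _⟩
    | tmul x m =>
      obtain ⟨x, hx⟩ := x
      have hx' := hx
      rw [← hq] at hx'
      have key : ∀ (y : A) (_ : y ∈ Ideal.map (algebraMap R A) q) (hy : y ∈ maximalIdeal A),
          ∀ m : M, ∃ t, φ t = (⟨y, hy⟩ : maximalIdeal A) ⊗ₜ[A] m := by
        intro y hy
        refine Submodule.span_induction ?_ ?_ ?_ ?_ hy
        · rintro _ ⟨r, hr, rfl⟩ hy m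
          exact ⟨(⟨r, hr⟩ : q) ⊗ₜ m, hφ _ _⟩
        · intro hy m
          refine ⟨0, ?_⟩
          have : (⟨0, hy⟩ : maximalIdeal A) = 0 := rfl
          rw [map_zero, this, TensorProduct.zero_tmul]
        · intro b c hb hc ihb ihc hbc m
          obtain ⟨s, hs⟩ := ihb (hq.le hb) m
          obtain ⟨t, ht⟩ := ihc (hq.le hc) m
          refine ⟨s + t, ?_⟩
          rw [map_add, hs, ht, ← TensorProduct.add_tmul]
          rfl
        · intro c b hb ihb hcb m
          obtain ⟨s, hs⟩ := ihb (hq.le hb) (c • m)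
          refine ⟨s, ?_⟩
          rw [hs, ← TensorProduct.smul_tmul]
          rfl
      exact key x hx' hx m
  have hcomp : ∀ t, TensorProduct.lid A M ((maximalIdeal A).subtype.rTensor M (φ t)) =
      TensorProduct.lid R M (q.subtype.rTensor M t) := by
    intro t
    induction t with
    | zero => simp
    | add x y hx hy => simp only [map_add, hx, hy]
    | tmul x m => simp [hφ, a]
  have hinj : Injective fun t =>
      TensorProduct.lid A M ((maximalIdeal A).subtype.rTensor M (φ t)) := by
    simp_rw [hcomp]
    exact (TensorProduct.lid R M).injective.comp
      (Module.Flat.rTensor_preserves_injective_linearMap _ (Submodule.injective_subtype q))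
  intro x y hxy
  obtain ⟨x, rfl⟩ := hsurj x
  obtain ⟨y, rfl⟩ := hsurj y
  rw [hinj (congrArg (TensorProduct.lid A M) hxy)]

/-- Free `A`-modules are flat over `R`, so each syzygy over `A` lowers the flat dimension over `R`,
until the flat syzygy is free over `A`. -/
theorem finFreeRes_of_flatDimLE [Module.Flat R A] (hq : q.map (algebraMap R A) = maximalIdeal A)
    {n : ℕ} (M : Type u) [AddCommGroup M] [Module A M] [Module R M] [IsScalarTower R A M]
    [Module.Finite A M] (h : FlatDimLE R n M) : FinFreeRes A n M := by
  induction n generalizing M with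
  | zero =>
    rw [flatDimLE_zero_iff] at h
    exact ⟨free_of_flat_of_map_eq_maximalIdeal hq M, inferInstance⟩
  | succ n ih =>
    obtain ⟨r, g, hg⟩ := Module.Finite.exists_fin' A M
    refine ⟨r, g, hg, ih _ ?_⟩
    have : Module.Flat R (Fin r → A) := Module.Flat.trans R A _
    exact (flatDimLE_succ_iff (K := LinearMap.ker g)
      (i := (LinearMap.ker g).subtype.restrictScalars R)
      (p := g.restrictScalars R) (Submodule.injective_subtype _)
      (LinearMap.exact_subtype_ker_map g) hg n).mp h

theorem CotangentIndep.le_embDim [Module.Flat R A] (hq : q.map (algebraMap R A) = maximalIdeal A)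
    {g : ℕ} {z : Fin g → R} (hz : CotangentIndep q z) : g ≤ embDim A := by
  have hm : ∀ i, algebraMap R A (z i) ∈ maximalIdeal A := fun i =>
    hq ▸ Ideal.mem_map_of_mem _ (hz.1 i)
  have hli : LinearIndependent (ResidueField A)
      (fun i => ((maximalIdeal A).toCotangent ⟨_, hm i⟩ : CotangentSpace A)) := by
    rw [Fintype.linearIndependent_iff]
    intro k hk i
    choose c hc using fun i => residue_surjective (k i)
    rw [← hc i, residue_eq_zero_iff, ← hq]
    refine hz.mem_map_of_flat (c := c) ?_ i
    have h1 : (maximalIdeal A).toCotangent (∑ i, c i • (⟨_, hm i⟩ : maximalIdeal A)) = 0 := by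
      rw [map_sum, ← hk]
      refine Finset.sum_congr rfl fun i _ => ?_
      rw [map_smul, ← hc i]
      rfl
    rw [Ideal.toCotangent_eq_zero] at h1
    rw [Ideal.map_pow, hq]
    simpa using h1
  have := hli.fintype_card_le_finrank
  rw [Fintype.card_fin] at this
  rwa [embDim, spanFinrank_maximalIdeal_eq_finrank_cotangentSpace]

/-- A prime containing the image of `Y` contracts to one containing `q`, so the maximal ideal is
minimal over that image and Krull's height theorem applies. -/
theorem ringKrullDim_le_of_le_radical (hq : q.map (algebraMap R A) = maximalIdeal A)
    {Y : Finset R} (hY : (Y : Set R) ⊆ q) (hrad : q ≤ (Ideal.span (Y : Set R)).radical) :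
    ringKrullDim A ≤ Y.card := by
  classical
  rw [← maximalIdeal_height_eq_ringKrullDim]
  have h1 : (maximalIdeal A) ∈ (Ideal.span
      ((Y.image (algebraMap R A) : Finset A) : Set A)).minimalPrimes := by
    rw [Finset.coe_image, ← Ideal.map_span]
    refine ⟨⟨inferInstance, ?_⟩, ?_⟩
    · rw [← hq]
      exact Ideal.map_mono (Ideal.span_le.mpr hY)
    · rintro P ⟨hP, hP'⟩ _
      rw [← hq, Ideal.map_le_iff_le_comap]
      refine hrad.trans ?_
      rw [Ideal.IsPrime.radical_le_iff (Ideal.IsPrime.comap _)]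
      exact Ideal.map_le_iff_le_comap.mp hP'
  have h2 := Ideal.height_le_card_of_mem_minimalPrimes_span_finset h1
  have h3 : (maximalIdeal A).height ≤ Y.card := h2.trans (Nat.cast_le.mpr Finset.card_image_le)
  exact_mod_cast h3

end UnramifiedFlat

/-! ### Adjoining variables until `q` generates the maximal ideal of `S`. -/

section PolynomialExtension

attribute [local instance] Polynomial.algebra

open Polynomial

theorem FlatDimLE.polynomial {R : Type u} [CommRing R] {S : Type v} [CommRing S] [Algebra R S]
    {n : ℕ} (h : FlatDimLE R n S) : FlatDimLE R[X] n S[X] := by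
  have h1 : FlatDimLE R n (ULift.{u} S) := h.of_equiv ULift.moduleEquiv.symm
  have h2 : FlatDimLE R[X] n (R[X] ⊗[R] ULift.{u} S) := FlatDimLE.baseChange.{u, v} h1
  refine h2.of_equiv ?_
  exact ((ULift.moduleEquiv (R := R) (M := S)).baseChange R R[X] _ _).trans
    (Algebra.IsPushout.equiv R R[X] S S[X]).toLinearEquiv

/-- Once `S` is an `R[X]`-algebra through `x`, the ring `S[X]` has a second `R[X]`-structure through
constants. Hiding `S[X]` behind `T` keeps the coefficientwise one. -/
theorem FlatDimLE.exists_eval_of_polynomial {R : Type u} [CommRing R] {S : Type v} [CommRing S]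
    [Algebra R S] {n : ℕ} (h : FlatDimLE R n S) (x : S) :
    ∃ (T : Type v) (_ : CommRing T) (_ : Algebra R[X] T) (f : T →+* S) (t : T),
      FlatDimLE R[X] n T ∧ (∀ p, f (algebraMap R[X] T p) = aeval x p) ∧ Surjective f ∧
      IsLeftRegular t ∧ ∀ a, f a = 0 ↔ ∃ b, t * b = a := by
  refine ⟨S[X], inferInstance, inferInstance, evalRingHom x, X - C x, h.polynomial, fun p => ?_,
    fun s => ⟨C s, eval_C⟩, (monic_X_sub_C x).isRegular.left, fun a => ?_⟩
  · exact eval_map_algebraMap p x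
  · rw [coe_evalRingHom, ← IsRoot.def, ← dvd_iff_isRoot]
    exact ⟨fun ⟨b, hb⟩ => ⟨b, hb.symm⟩, fun ⟨b, hb⟩ => ⟨b, hb.symm⟩⟩

/-- Multiplication by `X - x` on `S[X]` has cokernel `S`. -/
theorem FlatDimLE.polynomial_aeval {R : Type u} [CommRing R] {S : Type v} [CommRing S]
    [Algebra R S] {n : ℕ} (h : FlatDimLE R n S) (x : S) :
    letI := (aeval (R := R) x).toRingHom.toAlgebra
    FlatDimLE R[X] (n + 1) S := by
  obtain ⟨T, _, _, f, t, hT, hfT, hf, ht, hker⟩ := h.exists_eval_of_polynomial x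
  let _ := (aeval (R := R) x).toRingHom.toAlgebra
  let p : T →ₗ[R[X]] S :=
    { toFun := f
      map_add' := map_add f
      map_smul' := fun a b => by
        rw [Algebra.smul_def, map_mul, hfT]
        rfl }
  exact FlatDimLE.of_shortExact (i := LinearMap.mulLeft R[X] t) (p := p) (fun a b hab => ht hab)
    hker hf hT hT

variable {R : Type*} [CommRing R]

/-- The ideal of polynomials whose constant coefficient is in `q`. -/
noncomputable def Ideal.polynomialCons (q : Ideal R) : Ideal R[X] := q.comap constantCoeff

theorem Ideal.mem_polynomialCons {q : Ideal R} {p : R[X]} :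
    p ∈ q.polynomialCons ↔ p.coeff 0 ∈ q := Iff.rfl

theorem Ideal.polynomialCons_eq (q : Ideal R) : q.polynomialCons = q.map C ⊔ Ideal.span {X} := by
  refine le_antisymm (fun p hp => ?_) (sup_le ?_ ?_)
  · rw [← p.divX_mul_X_add, add_comm]
    exact Ideal.add_mem _ (Ideal.mem_sup_left (Ideal.mem_map_of_mem _ hp))
      (Ideal.mem_sup_right (Ideal.mul_mem_left _ _ (Ideal.mem_span_singleton_self X)))
  · rw [Ideal.map_le_iff_le_comap]
    intro a ha
    simpa [Ideal.mem_polynomialCons] using ha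
  · rw [Ideal.span_singleton_le_iff_mem, Ideal.mem_polynomialCons]
    simp

theorem Ideal.coeff_mem_of_mem_polynomialCons_sq {q : Ideal R} {p : R[X]}
    (hp : p ∈ q.polynomialCons ^ 2) : p.coeff 0 ∈ q ^ 2 ∧ p.coeff 1 ∈ q := by
  rw [sq] at hp ⊢
  refine Submodule.mul_induction_on hp (fun a ha b hb => ?_) fun a b ha hb => ?_
  · refine ⟨?_, ?_⟩
    · rw [mul_coeff_zero]
      exact Ideal.mul_mem_mul ha hb
    · rw [mul_coeff_one]
      exact Ideal.add_mem _ (Ideal.mul_mem_right _ _ ha) (Ideal.mul_mem_left _ _ hb)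
  · exact ⟨by rw [coeff_add]; exact Ideal.add_mem _ ha.1 hb.1,
      by rw [coeff_add]; exact Ideal.add_mem _ ha.2 hb.2⟩

/-- In a relation modulo the square, the constant coefficient settles the old generators; the
coefficient of `X` is `(r 0).coeff 0` plus an element of `q`. -/
theorem CotangentIndep.polynomialCons {q : Ideal R} {g : ℕ} {z : Fin g → R}
    (hz : CotangentIndep q z) :
    CotangentIndep q.polynomialCons (Fin.cons X (C ∘ z) : Fin (g + 1) → R[X]) := by
  refine ⟨fun i => ?_, fun r hr => ?_⟩
  · refine Fin.cases ?_ (fun i => ?_) i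
    · simp [Ideal.mem_polynomialCons]
    · simpa [Ideal.mem_polynomialCons] using hz.1 i
  · obtain ⟨h0, h1⟩ := Ideal.coeff_mem_of_mem_polynomialCons_sq hr
    rw [Fin.sum_univ_succ] at h0 h1
    simp only [Fin.cons_zero, Fin.cons_succ, comp_apply, coeff_add, mul_coeff_zero, coeff_X_zero,
      mul_zero, zero_add, finsetSum_coeff, coeff_C_zero, coeff_mul_C, coeff_mul_X] at h0 h1
    have h2 := hz.2 _ h0
    refine Fin.cases ?_ h2
    have h3 : ∑ i, (r (Fin.succ i)).coeff 1 * z i ∈ q :=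
      Ideal.sum_mem _ fun i _ => Ideal.mul_mem_left _ _ (hz.1 i)
    exact (Ideal.add_mem_iff_left _ h3).mp h1

/-- A Noetherian ring over which the local ring `S` has finite flat dimension, together with
a maximal ideal having at least `g` independent generators and being the radical of an ideal with at
most `d` generators. -/
structure FlatBase (S : Type v) [CommRing S] [IsLocalRing S] (𝔞 : Ideal S) (g d : ℕ) where
  carrier : Type u
  [commRing : CommRing carrier]
  [isNoetherianRing : IsNoetherianRing carrier]
  [algebra : Algebra carrier S]
  ideal : Ideal carrier
  [isMaximal : ideal.IsMaximal]
  map_eq : ideal.map (algebraMap carrier S) = 𝔞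
  exists_cotangentIndep : ∃ z : Fin g → carrier, CotangentIndep ideal z
  exists_finset : ∃ Y : Finset carrier, (Y : Set carrier) ⊆ ideal ∧
    ideal ≤ (Ideal.span (Y : Set carrier)).radical ∧ Y.card ≤ d
  exists_flatDimLE : ∃ n, FlatDimLE carrier n S

attribute [instance] FlatBase.commRing FlatBase.isNoetherianRing FlatBase.algebra
  FlatBase.isMaximal

/-- Send `X` to `x` and use the maximal ideal `(q, X)`. Both numerical bounds rise by one, so `g -
d` is unchanged. -/
theorem FlatBase.exists_adjoin {S : Type v} [CommRing S] [IsLocalRing S] {𝔞 : Ideal S} {g d : ℕ}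
    (B : FlatBase.{u} S 𝔞 g d) (x : S) :
    Nonempty (FlatBase.{u} S (𝔞 ⊔ Ideal.span {x}) (g + 1) (d + 1)) := by
  classical
  obtain ⟨z, hz⟩ := B.exists_cotangentIndep
  obtain ⟨Y, hY, hYr, hYc⟩ := B.exists_finset
  obtain ⟨n, hn⟩ := B.exists_flatDimLE
  let _ := (aeval (R := B.carrier) x).toRingHom.toAlgebra
  have halg : ∀ p : B.carrier[X], algebraMap B.carrier[X] S p = aeval x p := fun p => rfl
  have hmax : B.ideal.polynomialCons.IsMaximal :=
    Ideal.comap_isMaximal_of_surjective _ constantCoeff_surjective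
  refine ⟨@FlatBase.mk S _ _ _ _ _ B.carrier[X] _ _ _ B.ideal.polynomialCons hmax ?_
    ⟨_, hz.polynomialCons⟩ ⟨insert X (Y.image C), ?_, ?_, ?_⟩ ⟨n + 1, hn.polynomial_aeval x⟩⟩
  · rw [Ideal.polynomialCons_eq, Ideal.map_sup, Ideal.map_map, Ideal.map_span, Set.image_singleton,
      halg, aeval_X]
    have hcomp : (algebraMap B.carrier[X] S).comp C = algebraMap B.carrier S := by
      ext r
      simp [halg]
    rw [hcomp, B.map_eq]
  · intro p hp
    rw [Finset.coe_insert, Finset.coe_image] at hp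
    rw [Ideal.polynomialCons_eq]
    rcases hp with rfl | ⟨y, hy, rfl⟩
    · exact Ideal.mem_sup_right (Ideal.mem_span_singleton_self X)
    · exact Ideal.mem_sup_left (Ideal.mem_map_of_mem _ (hY hy))
  · rw [Ideal.polynomialCons_eq, Finset.coe_insert, Finset.coe_image]
    refine sup_le ?_ ?_
    · refine (Ideal.map_mono hYr).trans ((Ideal.map_radical_le _).trans (Ideal.radical_mono ?_))
      rw [Ideal.map_span]
      exact Ideal.span_mono (Set.subset_insert _ _)
    · rw [Ideal.span_singleton_le_iff_mem]
      exact Ideal.le_radical (Ideal.subset_span (Set.mem_insert _ _))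
  · exact (Finset.card_insert_le _ _).trans
      (Nat.succ_le_succ (Finset.card_image_le.trans hYc))

theorem FlatBase.exists_adjoin_finset {S : Type v} [CommRing S] [IsLocalRing S] {𝔞 : Ideal S}
    {g d : ℕ} (B : FlatBase.{u} S 𝔞 g d) (T : Finset S) :
    Nonempty (FlatBase.{u} S (𝔞 ⊔ Ideal.span (T : Set S)) (g + T.card) (d + T.card)) := by
  classical
  induction T using Finset.induction with
  | empty => simpa using ⟨B⟩
  | insert a T ha ih =>
    obtain ⟨B'⟩ := ih
    rw [Finset.card_insert_of_notMem ha, Finset.coe_insert, Ideal.span_insert,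
      sup_comm (Ideal.span {a}),
      ← sup_assoc]
    exact B'.exists_adjoin a

end PolynomialExtension

/-! ### Lifting an algebraic residue field extension, one element of `S` at a time. -/

theorem MvPolynomial.exists_aeval_X_eq {R S : Type*} [CommRing R] (s : S) (f : MvPolynomial S R) :
    ∃ F : Polynomial (MvPolynomial.supported R ({s}ᶜ : Set S)),
      Polynomial.aeval (MvPolynomial.X s) F = f := by
  induction f using MvPolynomial.induction_on with
  | C a => exact ⟨Polynomial.C (algebraMap R _ a), by rw [Polynomial.aeval_C]; rfl⟩
  | add p q hp hq =>
    obtain ⟨P, rfl⟩ := hp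
    obtain ⟨Q, rfl⟩ := hq
    exact ⟨P + Q, map_add _ _ _⟩
  | mul_X p t hp =>
    obtain ⟨P, rfl⟩ := hp
    by_cases ht : t = s
    · exact ⟨P * Polynomial.X, by rw [map_mul, Polynomial.aeval_X, ht]⟩
    · refine ⟨P * Polynomial.C ⟨MvPolynomial.X t, Algebra.subset_adjoin ⟨t, ht, rfl⟩⟩, ?_⟩
      rw [map_mul, Polynomial.aeval_C]
      rfl

/-- Monomial by monomial, the powers of `x` below the degree of its minimal polynomial are linearly
independent over `K`. -/
theorem eq_zero_of_sum_map_mul_C_pow {σ K L : Type*} [Field K] [Field L] [Algebra K L] {x : L}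
    (κ : ℕ → MvPolynomial σ K)
    (h : ∑ j ∈ Finset.range (minpoly K x).natDegree,
      MvPolynomial.map (algebraMap K L) (κ j) * MvPolynomial.C x ^ j = 0) {i : ℕ}
    (hi : i < (minpoly K x).natDegree) : κ i = 0 := by
  ext d
  have hd := congrArg (MvPolynomial.coeff d) h
  rw [MvPolynomial.coeff_sum, MvPolynomial.coeff_zero] at hd
  let p : Polynomial K := ∑ j ∈ Finset.range (minpoly K x).natDegree,
    Polynomial.monomial j ((κ j).coeff d)
  have hp0 : Polynomial.aeval x p = 0 := by
    rw [map_sum, ← hd]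
    refine Finset.sum_congr rfl fun j _ => ?_
    rw [Polynomial.aeval_monomial, ← MvPolynomial.C_pow, mul_comm (MvPolynomial.map _ _),
      MvPolynomial.coeff_C_mul, MvPolynomial.coeff_map, mul_comm]
  have hp : p = 0 := by
    by_contra hne
    have h1 := Polynomial.natDegree_le_natDegree (minpoly.degree_le_of_ne_zero K x hne hp0)
    have h2 : p.natDegree ≤ (minpoly K x).natDegree - 1 :=
      Polynomial.natDegree_sum_le_of_forall_le _ _ fun j hj =>
        (Polynomial.natDegree_monomial_le _).trans (Nat.le_sub_one_of_lt (Finset.mem_range.mp hj))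
    omega
  have hpi : p.coeff i = (κ i).coeff d := by
    rw [Polynomial.finsetSum_coeff]
    simp only [Polynomial.coeff_monomial]
    rw [Finset.sum_ite_eq', if_pos (Finset.mem_range.mpr hi)]
  rw [← hpi, hp, Polynomial.coeff_zero, MvPolynomial.coeff_zero]

section ResidueExtension

open MvPolynomial

variable (R : Type u) {S : Type v} [CommRing R] [CommRing S] [IsLocalRing S] [Algebra R S]

open Classical in
/-- The specialization of the variables in `T` to their residue classes. -/
noncomputable def residueSpec (T : Set S) :
    MvPolynomial S R →ₐ[R] MvPolynomial S (ResidueField S) :=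
  aeval fun s => if s ∈ T then C (residue S s) else X s

variable {R}

theorem residueSpec_X_of_mem {T : Set S} {s : S} (hs : s ∈ T) :
    residueSpec R T (X s) = C (residue S s) := by
  simp [residueSpec, hs]

theorem residueSpec_X_of_notMem {T : Set S} {s : S} (hs : s ∉ T) :
    residueSpec R T (X s) = X s := by
  simp [residueSpec, hs]

theorem residueSpec_algebraMap (T : Set S) (r : R) :
    residueSpec R T (C r) = C (residue S (algebraMap R S r)) :=
  (residueSpec R T).commutes r

theorem residueSpec_eq_of_vars {T T' : Set S} {f : MvPolynomial S R}
    (h : ∀ s ∈ f.vars, s ∈ T ↔ s ∈ T') : residueSpec R T f = residueSpec R T' f := by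
  classical
  refine eval₂Hom_congr' rfl (fun s hs _ => ?_) rfl
  simp only [h s hs]

theorem residueSpec_of_supported {T : Set S} {f : MvPolynomial S R} (hf : f ∈ supported R T) :
    residueSpec R T f = C (residue S (aeval id f)) := by
  refine Algebra.adjoin_induction ?_ ?_ ?_ ?_ hf
  · rintro _ ⟨s, hs, rfl⟩
    rw [residueSpec_X_of_mem hs, aeval_X, id]
  · intro r
    rw [AlgHom.commutes, AlgHom.commutes]
    rfl
  · intro a b _ _ ha hb
    simp only [map_add, ha, hb]
  · intro a b _ _ ha hb
    simp only [map_mul, ha, hb]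

theorem residueSpec_aeval (U : Set S) {V : Set S} (s : S) (F : Polynomial (supported R V)) :
    residueSpec R U (Polynomial.aeval (X s) F) =
      F.eval₂ ((residueSpec R U).toRingHom.comp (algebraMap (supported R V) _))
        (residueSpec R U (X s)) := by
  rw [Polynomial.aeval_def]
  exact Polynomial.hom_eval₂ F (algebraMap (supported R V) (MvPolynomial S R))
    (residueSpec R U).toRingHom (X s)

/-- The residue class of the value of a polynomial. -/
noncomputable def residueEval (V : Set S) : supported R V →+* ResidueField S :=
  ((residue S).comp (aeval (R := R) (id : S → S)).toRingHom).comp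
      (algebraMap (supported R V) (MvPolynomial S R))

theorem residueSpec_aeval_map {T U : Set S} (hU : T ⊆ U) {V : Subalgebra R (MvPolynomial S R)}
    (hV : supported R T ≤ V)
    (s : S) (P : Polynomial (supported R T)) :
    residueSpec R U (Polynomial.aeval (X s)
      (P.map (Subalgebra.inclusion hV : supported R T →+* V))) =
      Polynomial.aeval (residueSpec R U (X s)) (P.map (residueEval (R := R) T)) := by
  induction P using Polynomial.induction_on' with
  | add p q hp hq => simp only [Polynomial.map_add, map_add, hp, hq]
  | monomial n a =>
    rw [Polynomial.map_monomial, Polynomial.map_monomial, Polynomial.aeval_monomial,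
      Polynomial.aeval_monomial, map_mul, map_pow]
    congr 1
    exact residueSpec_of_supported (supported_mono hU a.2)

theorem exists_residueSpec_eq_comp {T T' : Set S} (h : T ⊆ T') :
    ∃ σ : MvPolynomial S (ResidueField S) →ₐ[R] MvPolynomial S (ResidueField S),
      residueSpec R T' = σ.comp (residueSpec R T) := by
  classical
  refine ⟨(aeval (R := ResidueField S) fun s =>
    if s ∈ T' then C (residue S s) else X s).restrictScalars R, ?_⟩
  refine algHom_ext fun s => ?_
  by_cases hs : s ∈ T
  · rw [residueSpec_X_of_mem (h hs), AlgHom.comp_apply, residueSpec_X_of_mem hs]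
    simp
  · rw [AlgHom.comp_apply, residueSpec_X_of_notMem hs]
    simp [residueSpec]

theorem ker_residueSpec_mono {T T' : Set S} (h : T ⊆ T') :
    RingHom.ker (residueSpec R T) ≤ RingHom.ker (residueSpec R T') := by
  obtain ⟨σ, hσ⟩ := exists_residueSpec_eq_comp (R := R) h
  intro f hf
  rw [RingHom.mem_ker] at hf ⊢
  rw [hσ, AlgHom.comp_apply, hf, map_zero]

variable [IsLocalRing R] [IsLocalHom (algebraMap R S)]

theorem ker_residueSpec_empty :
    RingHom.ker (residueSpec R (∅ : Set S)) = (maximalIdeal R).map C := by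
  have h : ∀ f, residueSpec R (∅ : Set S) f =
      map ((residue S).comp (algebraMap R S)) f := by
    intro f
    induction f using MvPolynomial.induction_on with
    | C a => rw [residueSpec_algebraMap, map_C]; rfl
    | add p q hp hq => simp only [map_add, hp, hq]
    | mul_X p s hp => rw [map_mul, map_mul, hp, map_X, residueSpec_X_of_notMem (Set.notMem_empty s)]
  have h2 : RingHom.ker (residueSpec R (∅ : Set S)) =
      RingHom.ker (map (σ := S) ((residue S).comp (algebraMap R S))) := by
    ext f
    rw [RingHom.mem_ker, RingHom.mem_ker, h]
  rw [h2, ker_map, ← RingHom.comap_ker, ker_residue, maximalIdeal_comap]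

/-- By algebraicity the field generated by the residues is already the algebra they generate, so its
elements are values of polynomials. -/
theorem exists_supported_of_mem_adjoin [Algebra.IsAlgebraic (ResidueField R) (ResidueField S)]
    {T : Set S} {x : ResidueField S}
    (hx : x ∈ IntermediateField.adjoin (ResidueField R) (residue S '' T)) :
    ∃ f ∈ supported R T, residue S (aeval id f) = x := by
  rw [← IntermediateField.mem_toSubalgebra, IntermediateField.adjoin_toSubalgebra] at hx
  refine Algebra.adjoin_induction ?_ ?_ ?_ ?_ hx
  · rintro _ ⟨s, hs, rfl⟩
    exact ⟨X s, Algebra.subset_adjoin ⟨s, hs, rfl⟩, by rw [aeval_X, id]⟩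
  · intro r
    obtain ⟨r, rfl⟩ := residue_surjective r
    exact ⟨algebraMap _ _ r, Subalgebra.algebraMap_mem _ r, by rw [AlgHom.commutes]; rfl⟩
  · rintro _ _ _ _ ⟨a, ha, rfl⟩ ⟨b, hb, rfl⟩
    exact ⟨a + b, add_mem ha hb, by simp only [map_add]⟩
  · rintro _ _ _ _ ⟨a, ha, rfl⟩ ⟨b, hb, rfl⟩
    exact ⟨a * b, mul_mem ha hb, by simp only [map_mul]⟩

theorem coeff_residueSpec_mem (T : Set S) (f : MvPolynomial S R) :
    residueSpec R T f ∈ (map (σ := S) (algebraMap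
      (IntermediateField.adjoin (ResidueField R) (residue S '' T)) (ResidueField S))).range := by
  induction f using MvPolynomial.induction_on with
  | C a =>
    rw [residueSpec_algebraMap]
    exact ⟨C (algebraMap (ResidueField R) _ (residue R a)), by rw [map_C]; rfl⟩
  | add p q hp hq => rw [map_add]; exact add_mem hp hq
  | mul_X p s hp =>
    rw [map_mul]
    refine mul_mem hp ?_
    by_cases hs : s ∈ T
    · rw [residueSpec_X_of_mem hs]
      exact ⟨C ⟨residue S s, IntermediateField.subset_adjoin _ _ ⟨s, hs, rfl⟩⟩, by rw [map_C]; rfl⟩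
    · rw [residueSpec_X_of_notMem hs]
      exact ⟨X s, by rw [map_X]⟩

/-- Specializing one more variable imposes a single new relation: `G` lifts the minimal polynomial
of the residue of `s` over the field generated by the residues of `T`. -/
theorem exists_residueSpec_insert [Algebra.IsAlgebraic (ResidueField R) (ResidueField S)]
    {T : Set S} {s : S} (hs : s ∉ T) :
    ∃ G : MvPolynomial S R, residueSpec R T G ≠ 0 ∧ residueSpec R (insert s T) G = 0 ∧
      ∀ f, residueSpec R (insert s T) f = 0 → ∃ f', residueSpec R T (f - G * f') = 0 := by
  let K := IntermediateField.adjoin (ResidueField R) (residue S '' T)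
  have hsint : IsIntegral K (residue S s) :=
    (Algebra.IsIntegral.isIntegral (R := ResidueField R) (residue S s)).tower_top
  set μ := minpoly K (residue S s) with hμ
  have hμm : μ.Monic := minpoly.monic hsint
  have hμpos : 0 < μ.natDegree := minpoly.natDegree_pos hsint
  have hμl : μ.map (algebraMap K (ResidueField S)) ∈ Polynomial.lifts (residueEval (R := R) T) := by
    rw [Polynomial.lifts_iff_coeff_lifts]
    intro i
    obtain ⟨f, hf, hfx⟩ := exists_supported_of_mem_adjoin (R := R) (μ.coeff i).2
    exact ⟨⟨f, hf⟩, by rw [Polynomial.coeff_map]; exact hfx⟩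
  obtain ⟨P, hPθ, hPd, hPm⟩ := Polynomial.lifts_and_natDegree_eq_and_monic hμl (hμm.map _)
  rw [hμm.natDegree_map] at hPd
  have hle : supported R T ≤ supported R ({s}ᶜ : Set S) :=
    supported_mono fun t ht => by rintro rfl; exact hs ht
  set ι := (Subalgebra.inclusion hle : supported R T →+* supported R ({s}ᶜ : Set S)) with hι
  set P' := P.map ι with hP'
  have hP'm : P'.Monic := hPm.map _
  have hP'd : P'.natDegree = μ.natDegree := (hPm.natDegree_map _).trans hPd
  have hspec : ∀ U, T ⊆ U → residueSpec R U (Polynomial.aeval (X s) P') =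
      Polynomial.aeval (residueSpec R U (X s)) (μ.map (algebraMap K (ResidueField S))) := by
    intro U hU
    rw [← hPθ, ← residueSpec_aeval_map hU hle]
  have hspecF : residueSpec R (insert s T) (Polynomial.aeval (X s) P') = 0 := by
    rw [hspec _ (Set.subset_insert _ _), residueSpec_X_of_mem (Set.mem_insert _ _)]
    have h1 : (C (residue S s) : MvPolynomial S (ResidueField S)) =
      algebraMap (ResidueField S) _ (residue S s) := rfl
    rw [h1, Polynomial.aeval_algebraMap_apply, Polynomial.aeval_map_algebraMap, minpoly.aeval,
      map_zero]
  refine ⟨Polynomial.aeval (X s) P', ?_, hspecF, fun f hf => ?_⟩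
  · rw [hspec T le_rfl, residueSpec_X_of_notMem hs]
    intro h0
    exact (hμm.map _).ne_zero ((transcendental_iff.mp (transcendental_X (ResidueField S) s)) _ h0)
  · obtain ⟨F, rfl⟩ := exists_aeval_X_eq s f
    have hdiv := Polynomial.modByMonic_add_div F P'
    set W := F %ₘ P' with hW
    -- The remainder has degree below that of the minimal polynomial, so its vanishing at the
    -- residue of `s` kills each of its coefficients under `residueSpec R T`.
    have hWd : W.natDegree < μ.natDegree := by
      rw [← hP'd]
      refine Polynomial.natDegree_modByMonic_lt F hP'm fun h => ?_
      rw [h, Polynomial.natDegree_one] at hP'd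
      exact hμpos.ne hP'd
    have hW0 : residueSpec R (insert s T) (Polynomial.aeval (X s) W) = 0 := by
      rw [← hdiv, map_add, map_mul, map_add, map_mul, hspecF, zero_mul, add_zero] at hf
      exact hf
    refine ⟨Polynomial.aeval (X s) (F /ₘ P'), ?_⟩
    have hsub : Polynomial.aeval (X s : MvPolynomial S R) F - Polynomial.aeval (X s) P' *
        Polynomial.aeval (X s) (F /ₘ P') = Polynomial.aeval (X s) W := by
      rw [sub_eq_iff_eq_add, ← map_mul, ← map_add, hdiv]
    rw [hsub]
    have hcongr : ∀ i, residueSpec R (insert s T) (W.coeff i : MvPolynomial S R) =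
        residueSpec R T (W.coeff i : MvPolynomial S R) := fun i =>
      residueSpec_eq_of_vars fun t ht => by
        have : t ∈ ({s}ᶜ : Set S) :=
            (mem_supported (σ := S) (R := R)).mp (W.coeff i).2 (Finset.mem_coe.mpr ht)
        exact ⟨fun h => h.resolve_left this, Or.inr⟩
    have hzero : ∀ i, residueSpec R T (W.coeff i : MvPolynomial S R) = 0 := by
      choose κ hκ using fun i => coeff_residueSpec_mem T (W.coeff i : MvPolynomial S R)
      rw [residueSpec_aeval, residueSpec_X_of_mem (Set.mem_insert _ _),
        Polynomial.eval₂_eq_sum_range' _ hWd] at hW0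
      intro i
      by_cases hi : i < μ.natDegree
      · rw [← hκ i, eq_zero_of_sum_map_mul_C_pow κ ?_ hi]
        · exact map_zero _
        · rw [← hW0]
          refine Finset.sum_congr rfl fun j _ => ?_
          congr 1
          exact (hκ j).trans (hcongr j).symm
      · rw [Polynomial.coeff_eq_zero_of_natDegree_lt (by omega)]
        exact map_zero _
    rw [residueSpec_aeval, Polynomial.eval₂_eq_sum_range]
    refine Finset.sum_eq_zero fun i _ => ?_
    rw [RingHom.comp_apply]
    exact (congrArg (· * _) (hzero i)).trans (zero_mul _)

theorem residueSpec_map_maximalIdeal (T : Set S) {f : MvPolynomial S R}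
    (hf : f ∈ (maximalIdeal R).map C) : residueSpec R T f = 0 := by
  rw [← ker_residueSpec_empty (S := S)] at hf
  exact ker_residueSpec_mono (Set.empty_subset T) hf

/-- An ideal of relations, flat modulo the maximal ideal, among the variables in `T`. -/
def IsResidueLift (p : Set S × Ideal (MvPolynomial S R)) : Prop :=
  p.2 ≤ RingHom.ker (aeval (R := R) (id : S → S)) ∧
  p.2 ⊓ (maximalIdeal R).map C ≤ (maximalIdeal R).map C * p.2 ∧
  p.2 ⊔ (maximalIdeal R).map C = RingHom.ker (residueSpec R p.1)

/-- The value of `G` lies in 𝔫 = 𝔪S, so subtracting some `c` in 𝔪B (with `B` the polynomial ring)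
puts `G - c` in the kernel of evaluation. If `i + b(G - c)` lies in 𝔪B, specialization gives `b G =
0` in a domain where `G ≠ 0`, so `b ∈ I + 𝔪B`; this yields the intersection condition for `I + (G -
c)`. -/
theorem IsResidueLift.exists_insert [Algebra.IsAlgebraic (ResidueField R) (ResidueField S)]
    (hm : (maximalIdeal R).map (algebraMap R S) = maximalIdeal S)
    {p : Set S × Ideal (MvPolynomial S R)} (hp : IsResidueLift p) {s : S} (hs : s ∉ p.1) :
    ∃ J, p.2 ≤ J ∧ IsResidueLift (insert s p.1, J) := by
  obtain ⟨T, I⟩ := p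
  obtain ⟨h1, h2, h3⟩ := hp
  dsimp only at h1 h2 h3 hs ⊢
  set Q : Ideal (MvPolynomial S R) := (maximalIdeal R).map C with hQ
  obtain ⟨G, hG0, hG, hdiv⟩ := exists_residueSpec_insert (R := R) hs
  have hψ : Surjective (aeval (R := R) (id : S → S)) := fun t => ⟨X t, aeval_X _ t⟩
  have hψres : ∀ f, residueSpec R (insert s T) f = 0 →
      aeval (R := R) (id : S → S) f ∈ maximalIdeal S := by
    intro f hf
    rw [← residue_eq_zero_iff]
    have hf' := ker_residueSpec_mono (Set.subset_univ (insert s T)) hf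
    rw [RingHom.mem_ker, residueSpec_of_supported (by rw [supported_univ]; trivial)] at hf'
    exact (C_injective _ _) (hf'.trans (map_zero C).symm)
  have hQS : Q.map (aeval (R := R) (id : S → S)).toRingHom = maximalIdeal S := by
    rw [hQ, Ideal.map_map, ← hm]
    congr 1
    ext r
    simp
  obtain ⟨c, hcQ, hc⟩ : ∃ c ∈ Q, aeval (R := R) (id : S → S) c = aeval (R := R) (id : S → S) G := by
    have := hψres G hG
    rw [← hQS] at this
    exact (Ideal.mem_map_iff_of_surjective _ hψ).mp this
  have hIT : I ≤ RingHom.ker (residueSpec R T) := h3 ▸ le_sup_left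
  have hQT : ∀ {U : Set S} {f}, f ∈ Q → residueSpec R U f = 0 :=
    fun hf => residueSpec_map_maximalIdeal _ hf
  refine ⟨I ⊔ Ideal.span {G - c}, le_sup_left, sup_le h1 ?_, ?_, ?_⟩
  · rw [Ideal.span_singleton_le_iff_mem, RingHom.mem_ker, map_sub, hc, sub_self]
  · rintro x ⟨hx, hxQ⟩
    obtain ⟨i, hi, y, hy, rfl⟩ := Submodule.mem_sup.mp hx
    obtain ⟨b, rfl⟩ := Ideal.mem_span_singleton'.mp hy
    have hbT : residueSpec R T b = 0 := by
      have h0 : residueSpec R T (i + b * (G - c)) = 0 := hQT hxQ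
      rw [map_add, (hIT hi : residueSpec R T i = 0), zero_add, map_mul,
        map_sub, hQT hcQ, sub_zero] at h0
      exact (mul_eq_zero.mp h0).resolve_right hG0
    have hb : b ∈ I ⊔ Q := by rw [h3]; exact hbT
    obtain ⟨j, hj, q, hq, rfl⟩ := Submodule.mem_sup.mp hb
    have hqQ : q * (G - c) ∈ Q := Ideal.mul_mem_right _ _ hq
    have hiI : i + j * (G - c) ∈ I := Ideal.add_mem _ hi (Ideal.mul_mem_right _ _ hj)
    have hsplit : i + (j + q) * (G - c) = (i + j * (G - c)) + q * (G - c) := by ring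
    rw [hsplit] at hxQ ⊢
    refine Ideal.add_mem _ (Ideal.mul_mono_right le_sup_left (h2 ⟨hiI, ?_⟩))
      (Ideal.mul_mem_mul hq (Ideal.mem_sup_right (Ideal.mem_span_singleton_self _)))
    exact (Ideal.add_mem_iff_left _ hqQ).mp hxQ
  · refine le_antisymm (sup_le (sup_le ?_ ?_) fun f hf => hQT hf) fun f hf => ?_
    · exact hIT.trans (ker_residueSpec_mono (Set.subset_insert _ _))
    · rw [Ideal.span_singleton_le_iff_mem, RingHom.mem_ker, map_sub, hG, hQT hcQ, sub_zero]
    · obtain ⟨f', hf'⟩ := hdiv f hf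
      have h4 : f - G * f' ∈ I ⊔ Q := by rw [h3]; exact hf'
      have h5 : f = (f - G * f') + ((G - c) * f' + c * f') := by ring
      rw [h5]
      refine Ideal.add_mem _ (sup_le_sup_right (le_sup_left : I ≤ _) Q h4) (Ideal.add_mem _ ?_ ?_)
      · exact Ideal.mul_mem_right _ _
          (Ideal.mem_sup_left (Ideal.mem_sup_right (Ideal.mem_span_singleton_self _)))
      · exact Ideal.mul_mem_right _ _ (Ideal.mem_sup_right hcQ)

/-- A polynomial has finitely many variables, so its specialization over the union already occurs at
one member of the chain. -/
theorem IsResidueLift.sSup {c : Set (Set S × Ideal (MvPolynomial S R))}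
    (hc : ∀ p ∈ c, IsResidueLift p) (hchain : IsChain (· ≤ ·) c) (hne : c.Nonempty) :
    IsResidueLift (⋃ p ∈ c, p.1, ⨆ p ∈ c, p.2) := by
  have hdir : DirectedOn (· ≤ ·) c := hchain.directedOn
  have hdir2 : DirectedOn (· ≤ ·) ((fun p : Set S × Ideal (MvPolynomial S R) => p.2) '' c) :=
    (hdir.mono_comp fun _ _ h => h.2)
  have hmem : ∀ x, x ∈ (⨆ p ∈ c, p.2) ↔ ∃ p ∈ c, x ∈ p.2 := by
    intro x
    rw [← sSup_image, Submodule.mem_sSup_of_directed (hne.image _) hdir2]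
    exact Set.exists_mem_image
  refine ⟨iSup₂_le fun p hp => (hc p hp).1, ?_, ?_⟩
  · rintro x ⟨hx, hxQ⟩
    obtain ⟨p, hp, hxp⟩ := (hmem x).mp hx
    exact Ideal.mul_mono_right (le_iSup₂_of_le p hp le_rfl) ((hc p hp).2.1 ⟨hxp, hxQ⟩)
  · refine le_antisymm (sup_le (iSup₂_le fun p hp => ?_) fun f hf =>
      residueSpec_map_maximalIdeal _ hf) fun f hf => ?_
    · exact (le_sup_left.trans (hc p hp).2.2.le).trans
        (ker_residueSpec_mono (Set.subset_biUnion_of_mem hp))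
    · classical
      obtain ⟨p, hp, hpf⟩ := DirectedOn.exists_mem_subset_of_finset_subset_biUnion
        (f := fun p : Set S × Ideal (MvPolynomial S R) => p.1) hne
        (hdir.mono fun _ _ h => h.1) (s := {s ∈ f.vars | s ∈ ⋃ p ∈ c, p.1})
        (fun s hs => (Finset.mem_filter.mp hs).2)
      have hf' : residueSpec R p.1 f = 0 := by
        rw [← RingHom.mem_ker.mp hf]
        refine residueSpec_eq_of_vars fun s hs => ⟨fun h => Set.mem_biUnion hp h, fun h => ?_⟩
        exact hpf (Finset.mem_coe.mpr (Finset.mem_filter.mpr ⟨hs, h⟩))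
      have hf2 : f ∈ p.2 ⊔ (maximalIdeal R).map C := by rw [(hc p hp).2.2]; exact hf'
      exact sup_le_sup_right (le_iSup₂ (f := fun p (_ : p ∈ c) => p.2) p hp) _ hf2

theorem exists_isResidueLift_univ [Algebra.IsAlgebraic (ResidueField R) (ResidueField S)]
    (hm : (maximalIdeal R).map (algebraMap R S) = maximalIdeal S) :
    ∃ I : Ideal (MvPolynomial S R), IsResidueLift (Set.univ, I) := by
  have h0 : IsResidueLift ((∅ : Set S), (⊥ : Ideal (MvPolynomial S R))) := by
    refine ⟨bot_le, inf_le_left.trans bot_le, ?_⟩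
    rw [bot_sup_eq, ker_residueSpec_empty]
  obtain ⟨⟨T, I⟩, -, hmax⟩ := zorn_le_nonempty₀
    {p : Set S × Ideal (MvPolynomial S R) | IsResidueLift p}
    (fun c hc hchain y hy => ⟨_, IsResidueLift.sSup hc hchain ⟨y, hy⟩, fun z hz =>
      ⟨Set.subset_biUnion_of_mem hz, le_iSup₂_of_le z hz le_rfl⟩⟩) _ h0
  have hT : T = Set.univ := by
    by_contra hne
    obtain ⟨s, hs⟩ := (Set.ne_univ_iff_exists_notMem T).mp hne
    obtain ⟨J, hJ, hlift⟩ := hmax.prop.exists_insert hm hs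
    exact hs ((hmax.le_of_ge hlift ⟨Set.subset_insert _ _, hJ⟩).1 (Set.mem_insert _ _))
  exact ⟨I, hT ▸ hmax.prop⟩

end ResidueExtension

/-! ### The transcendental part of the residue field extension. -/

section ResidueField

open MvPolynomial

/-- Map variables to lifts of a transcendence basis. Algebraic independence says that the preimage
of 𝔫 is exactly `q` extended to the polynomial ring, and `R'` is the localization there. -/
theorem exists_flat_isAlgebraic_residueField {R : Type u} [CommRing R] {S : Type v} [CommRing S]
    [IsLocalRing S] [Algebra R S] {q : Ideal R} [q.IsMaximal]
    (hq : q.map (algebraMap R S) = maximalIdeal S) :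
    ∃ (R' : Type max u v) (_ : CommRing R') (_ : IsLocalRing R') (_ : Algebra R R')
      (_ : Algebra R' S) (_ : IsScalarTower R R' S) (_ : IsLocalHom (algebraMap R' S)),
      Module.Flat R R' ∧ q.map (algebraMap R R') = maximalIdeal R' ∧
      Algebra.IsAlgebraic (ResidueField R') (ResidueField S) := by
  have hker : ∀ r ∈ q, (residue S).comp (algebraMap R S) r = 0 := fun r hr => by
    rw [RingHom.comp_apply, residue_eq_zero_iff, ← hq]
    exact Ideal.mem_map_of_mem _ hr
  have hker' : ∀ r, (residue S).comp (algebraMap R S) r = 0 → r ∈ q := by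
    intro r hr
    have h1 : q = RingHom.ker ((residue S).comp (algebraMap R S)) :=
      Ideal.IsMaximal.eq_of_le inferInstance (RingHom.ker_ne_top _) hker
    rw [h1]
    exact hr
  let _ : Algebra (R ⧸ q) (ResidueField S) := (Ideal.Quotient.lift q _ hker).toAlgebra
  have hmk : ∀ r : R, algebraMap (R ⧸ q) (ResidueField S) (Ideal.Quotient.mk q r) =
    residue S (algebraMap R S r) := fun r => rfl
  have hinj : Injective (algebraMap (R ⧸ q) (ResidueField S)) := by
    rw [injective_iff_map_eq_zero]
    intro a ha
    obtain ⟨r, rfl⟩ := Ideal.Quotient.mk_surjective a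
    exact Ideal.Quotient.eq_zero_iff_mem.mpr (hker' r ha)
  have : FaithfulSMul (R ⧸ q) (ResidueField S) :=
      (faithfulSMul_iff_algebraMap_injective _ _).mpr hinj
  obtain ⟨s, hs⟩ := exists_isTranscendenceBasis (R ⧸ q) (ResidueField S)
  choose y hy using fun i : s => residue_surjective (R := S) (i : ResidueField S)
  let θ : MvPolynomial s R →ₐ[R] S := aeval y
  let p : Ideal (MvPolynomial s R) := (maximalIdeal S).comap θ
  have hpp : p.IsPrime := Ideal.comap_isPrime _ _
  have hθ : ∀ f, residue S (θ f) =
      aeval (Subtype.val : s → ResidueField S) (map (Ideal.Quotient.mk q) f) := by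
    intro f
    induction f using MvPolynomial.induction_on with
    | C a => rw [map_C, MvPolynomial.algHom_C, MvPolynomial.algHom_C, hmk]
    | add a b ha hb => simp only [map_add, ha, hb]
    | mul_X a i ha =>
      simp only [map_mul, ha, map_X, aeval_X]
      rw [← hy i]
      congr 1
      simp [θ]
  have hp : p = q.map C := by
    have h1 : q.map (C (σ := s)) = RingHom.ker (map (σ := s) (Ideal.Quotient.mk q)) := by
      rw [ker_map, Ideal.mk_ker]
    ext f
    rw [h1, RingHom.mem_ker, Ideal.mem_comap, ← residue_eq_zero_iff]
    change residue S (θ f) = 0 ↔ _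
    rw [hθ]
    exact map_eq_zero_iff _ hs.1
  have hunit : ∀ f : p.primeCompl, IsUnit (θ f) := by
    intro f
    by_contra h
    exact f.2 ((mem_maximalIdeal _).mpr h)
  let φ : Localization.AtPrime p →+* S :=
      IsLocalization.lift (M := p.primeCompl) (g := (θ : MvPolynomial s R →+* S)) hunit
  have hφ : ∀ f, φ (algebraMap _ _ f) = θ f := fun f => IsLocalization.lift_eq _ f
  let _ : Algebra (Localization.AtPrime p) S := φ.toAlgebra
  have htower : IsScalarTower R (Localization.AtPrime p) S := by
    refine IsScalarTower.of_algebraMap_eq fun r => ?_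
    rw [IsScalarTower.algebraMap_apply R (MvPolynomial s R) (Localization.AtPrime p)]
    refine ((hφ _).trans (θ.commutes r)).symm
  have hmax : q.map (algebraMap R (Localization.AtPrime p)) = maximalIdeal _ := by
    rw [← Localization.AtPrime.map_eq_maximalIdeal]
    refine Eq.trans ?_ (congrArg (Ideal.map (algebraMap _ (Localization.AtPrime p))) hp).symm
    rw [Ideal.map_map]
    rfl
  have hloc : IsLocalHom (algebraMap (Localization.AtPrime p) S) := by
    refine ((local_hom_TFAE (algebraMap (Localization.AtPrime p) S)).out 0 2).mpr ?_
    rw [← hmax, Ideal.map_map, ← IsScalarTower.algebraMap_eq, hq]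
  refine ⟨Localization.AtPrime p, inferInstance, inferInstance, inferInstance, inferInstance,
    htower, hloc, ?_, hmax, ?_⟩
  · have : Module.Flat (MvPolynomial s R) (Localization.AtPrime p) :=
      IsLocalization.flat _ p.primeCompl
    exact Module.Flat.trans R (MvPolynomial s R) _
  · have hrange : ∀ z ∈ Algebra.adjoin (R ⧸ q) (Set.range (Subtype.val : s → ResidueField S)),
        z ∈ (algebraMap (ResidueField (Localization.AtPrime p)) (ResidueField S)).range := by
      intro z hz
      have hres : ∀ f : MvPolynomial s R, residue S (θ f) ∈
          (algebraMap (ResidueField (Localization.AtPrime p)) (ResidueField S)).range := fun f =>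
        ⟨residue _ (algebraMap _ _ f), congrArg (residue S) (hφ f)⟩
      refine Algebra.adjoin_induction ?_ ?_ ?_ ?_ hz
      · rintro _ ⟨i, rfl⟩
        have := hres (X i)
        rwa [hθ, map_X, aeval_X] at this
      · intro r
        obtain ⟨r, rfl⟩ := Ideal.Quotient.mk_surjective r
        have := hres (C r)
        rwa [hθ, map_C, algHom_C] at this
      · exact fun a b _ _ ha hb => add_mem ha hb
      · exact fun a b _ _ ha hb => mul_mem ha hb
    have halg := hs.isAlgebraic
    refine ⟨fun z => ?_⟩
    obtain ⟨P, hP0, hP⟩ := halg.isAlgebraic z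
    have hlift : P.map (algebraMap _ (ResidueField S)) ∈ Polynomial.lifts
        (algebraMap (ResidueField (Localization.AtPrime p)) (ResidueField S)) := by
      rw [Polynomial.lifts_iff_coeff_lifts]
      intro n
      rw [Polynomial.coeff_map]
      exact hrange _ (P.coeff n).2
    obtain ⟨Q, hQ⟩ := hlift
    rw [Polynomial.coe_mapRingHom] at hQ
    refine ⟨Q, ?_, ?_⟩
    · rintro rfl
      rw [Polynomial.map_zero, eq_comm,
        Polynomial.map_eq_zero_iff (FaithfulSMul.algebraMap_injective _ _)] at hQ
      exact hP0 hQ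
    · rw [← Polynomial.aeval_map_algebraMap (ResidueField S), hQ, Polynomial.aeval_map_algebraMap,
        hP]

end ResidueField

/-! ### Flatness of `B/I` modulo powers of `q`. -/

section IdealMulInf

theorem exists_sum_of_mem_span_range_mul {B ι : Type*} [CommRing B] [Fintype ι] {g : ι → B}
    {I : Ideal B} {x : B} (hx : x ∈ Ideal.span (Set.range g) * I) :
    ∃ y : ι → B, (∀ i, y i ∈ I) ∧ x = ∑ i, g i * y i := by
  refine Submodule.mul_induction_on hx (fun a ha b hb => ?_) ?_
  · obtain ⟨c, rfl⟩ := Ideal.mem_span_range_iff_exists_fun.mp ha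
    refine ⟨fun i => c i * b, fun i => Ideal.mul_mem_left _ _ hb, ?_⟩
    rw [Finset.sum_mul]
    exact Finset.sum_congr rfl fun i _ => by ring
  · rintro _ _ ⟨y, hy, rfl⟩ ⟨z, hz, rfl⟩
    refine ⟨fun i => y i + z i, fun i => Ideal.add_mem _ (hy i) (hz i), ?_⟩
    rw [← Finset.sum_add_distrib]
    exact Finset.sum_congr rfl fun i _ => by ring

variable {R B : Type*} [CommRing R] [CommRing B] [Algebra R B]

/-- Colon ideals `(J : a)` commute with flat extension; the equational criterion is applied to `a b
- ∑ g i c i = 0`. -/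
theorem Ideal.mem_map_of_mul_mem_of_flat [IsNoetherianRing R] [Module.Flat R B] {J q : Ideal R}
    {a : R} (ha : ∀ r, a * r ∈ J → r ∈ q) {b : B}
    (hb : algebraMap R B a * b ∈ J.map (algebraMap R B)) : b ∈ q.map (algebraMap R B) := by
  obtain ⟨m, g, rfl⟩ := Submodule.fg_iff_exists_fin_generating_family.mp (IsNoetherian.noetherian J)
  have hb' : algebraMap R B a * b ∈ (Ideal.span (Set.range g)).map (algebraMap R B) := hb
  rw [Ideal.map_span, ← Set.range_comp] at hb'
  obtain ⟨c, hc⟩ := Ideal.mem_span_range_iff_exists_fun.mp hb'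
  have hrel : ∑ i, (Fin.cons a (fun i => - g i) : Fin (m + 1) → R) i •
      (Fin.cons b c : Fin (m + 1) → B) i = 0 := by
    rw [Fin.sum_univ_succ]
    simp only [Fin.cons_zero, Fin.cons_succ, Algebra.smul_def, map_neg, neg_mul,
      Finset.sum_neg_distrib]
    rw [← hc, ← sub_eq_add_neg, sub_eq_zero]
    exact Finset.sum_congr rfl fun i _ => mul_comm _ _
  obtain ⟨k, r, y, hy, hr⟩ := Module.Flat.iff_forall_isTrivialRelation.mp ‹_› hrel
  have hb0 : b = ∑ j, r 0 j • y j := hy 0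
  rw [hb0]
  refine Ideal.sum_mem _ fun j _ => ?_
  rw [Algebra.smul_def]
  refine Ideal.mul_mem_right _ _ (Ideal.mem_map_of_mem _ (ha _ ?_))
  have h1 := hr j
  rw [Fin.sum_univ_succ] at h1
  simp only [Fin.cons_zero, Fin.cons_succ, neg_mul, Finset.sum_neg_distrib] at h1
  rw [← sub_eq_add_neg, sub_eq_zero] at h1
  rw [h1]
  exact Submodule.sum_mem _ fun i _ => Ideal.mul_mem_right _ _ (Submodule.subset_span ⟨i, rfl⟩)

/-- The inclusion expresses Tor₁(R/J, B/I) = 0. Noetherian induction passes to `J + (a)` with `(J :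
a) = q`: there `x = y + a z` with `y ∈ JB·I` and `z ∈ I`. Since `a z ∈ JB`, flatness puts `z` in
`qB`, hence in `qB·I`, and `a q ⊆ J`. -/
theorem Ideal.inf_map_le_map_mul_of_pow_le [IsNoetherianRing R] [Module.Flat R B] {q : Ideal R}
    [hq : q.IsMaximal] {I : Ideal B}
    (hI : I ⊓ q.map (algebraMap R B) ≤ q.map (algebraMap R B) * I) {n : ℕ} {J : Ideal R}
    (hJ : q ^ n ≤ J) : I ⊓ J.map (algebraMap R B) ≤ J.map (algebraMap R B) * I := by
  classical
  induction J using IsNoetherian.induction with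
  | hgt J ih =>
  by_cases hJt : J = ⊤
  · rw [hJt, Ideal.map_top, Ideal.top_mul]
    exact inf_le_left
  -- Take `a` in the last power of `q` not contained in `J`.
  obtain ⟨a, haJ, haq⟩ : ∃ a ∉ J, ∀ r ∈ q, a * r ∈ J := by
    have hex : ∃ m, q ^ m ≤ J := ⟨n, hJ⟩
    have hm := Nat.find_spec hex
    obtain ⟨m, hm'⟩ : ∃ m, Nat.find hex = m + 1 := by
      refine Nat.exists_eq_succ_of_ne_zero fun h0 => hJt ?_
      rw [h0, pow_zero, Ideal.one_eq_top] at hm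
      exact top_le_iff.mp hm
    obtain ⟨a, ha, haJ⟩ := SetLike.not_le_iff_exists.mp (Nat.find_min hex (m := m) (by omega))
    refine ⟨a, haJ, fun r hr => hm ?_⟩
    rw [hm', pow_succ]
    exact Ideal.mul_mem_mul ha hr
  have hcolon : ∀ r, a * r ∈ J → r ∈ q := by
    intro r hr
    by_contra hrq
    obtain ⟨b, c, hc, hbc⟩ := hq.exists_inv hrq
    refine haJ ?_
    have : a = b * (a * r) + a * c := by linear_combination a * (- hbc)
    rw [this]
    exact Ideal.add_mem _ (Ideal.mul_mem_left _ _ hr) (haq c hc)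
  rintro x ⟨hxI, hxJ⟩
  have hlt : J < J ⊔ Ideal.span {a} :=
    lt_of_le_of_ne le_sup_left fun h => haJ
        (h ▸ Ideal.mem_sup_right (Ideal.mem_span_singleton_self a))
  have hx := ih _ hlt (hJ.trans le_sup_left) ⟨hxI, Ideal.map_mono le_sup_left hxJ⟩
  rw [Ideal.map_sup, Ideal.map_span, Set.image_singleton, Ideal.sup_mul] at hx
  obtain ⟨y, hy, w, hw, rfl⟩ := Submodule.mem_sup.mp hx
  obtain ⟨z, hz, rfl⟩ := Ideal.mem_span_singleton_mul.mp hw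
  refine Ideal.add_mem _ hy ?_
  have hyJ : y ∈ Ideal.map (algebraMap R B) J := Ideal.mul_le_left hy
  have hzJ : algebraMap R B a * z ∈ Ideal.map (algebraMap R B) J :=
    (Ideal.add_mem_iff_right _ hyJ).mp hxJ
  have hzq := hI ⟨hz, Ideal.mem_map_of_mul_mem_of_flat hcolon hzJ⟩
  have hle : Ideal.span {algebraMap R B a} * (q.map (algebraMap R B) * I) ≤
      Ideal.map (algebraMap R B) J * I := by
    rw [← mul_assoc]
    refine Ideal.mul_mono_left ?_
    rw [← Set.image_singleton, ← Ideal.map_span, ← Ideal.map_mul]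
    refine Ideal.map_mono ?_
    rw [Ideal.span_singleton_mul_le_iff]
    exact haq
  exact hle (Ideal.mul_mem_mul (Ideal.mem_span_singleton_self _) hzq)

/-- Relations modulo powers of `q` come from relations over `R` modulo powers of `q`. -/
def FlatModPow (q : Ideal R) (C : Type*) [CommRing C] [Algebra R C] : Prop :=
  ∀ (n m : ℕ) (f : Fin m → R) (c : Fin m → C),
    ∑ i, f i • c i ∈ (q ^ n).map (algebraMap R C) →
    ∃ (k : ℕ) (r : Fin m → Fin k → R) (y : Fin k → C),
      (∀ i, c i = ∑ j, r i j • y j) ∧ ∀ j, ∑ i, f i * r i j ∈ q ^ n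

/-- Lifted to `B`, the relation has an error in `q ^ n B + I`. Adding generators of `q ^ n` to the
`f i` leaves an error `t ∈ I`, which the preceding lemma writes as a combination of the enlarged
family with coefficients in `I`. Correcting the lifts by these gives an exact relation over the flat
ring `B`. -/
theorem flatModPow_quotient [IsNoetherianRing R] [Module.Flat R B] {q : Ideal R}
    [q.IsMaximal] {I : Ideal B}
    (hI : I ⊓ q.map (algebraMap R B) ≤ q.map (algebraMap R B) * I) : FlatModPow q (B ⧸ I) := by
  intro n m f c hc
  obtain ⟨l, g, hg⟩ := Submodule.fg_iff_exists_fin_generating_family.mp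
    (IsNoetherian.noetherian (q ^ n))
  change Ideal.span (Set.range g) = q ^ n at hg
  choose b hb using fun i => Ideal.Quotient.mk_surjective (I := I) (c i)
  have hmk : ∀ (r : R) (x : B), Ideal.Quotient.mk I (r • x) = r • Ideal.Quotient.mk I x :=
    fun r x => rfl
  have h1 : ∑ i, f i • b i ∈ (q ^ n).map (algebraMap R B) ⊔ I := by
    have h2 : Ideal.Quotient.mk I (∑ i, f i • b i) ∈
        ((q ^ n).map (algebraMap R B)).map (Ideal.Quotient.mk I) := by
      rw [Ideal.map_map, map_sum]
      simp only [hmk, hb]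
      exact hc
    rw [← Ideal.mem_comap, Ideal.comap_map_of_surjective _ Ideal.Quotient.mk_surjective,
      ← RingHom.ker_eq_comap_bot, Ideal.mk_ker] at h2
    exact h2
  obtain ⟨u, hu, t, ht, hut⟩ := Submodule.mem_sup.mp h1
  rw [← hg, Ideal.map_span, ← Set.range_comp] at hu
  obtain ⟨e, rfl⟩ := Ideal.mem_span_range_iff_exists_fun.mp hu
  let F : Fin m ⊕ Fin l → R := Sum.elim f g
  let w : Fin m ⊕ Fin l → B := Sum.elim b (fun i => - e i)
  have htw : t = ∑ s, F s • w s := by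
    rw [Fintype.sum_sum_type]
    simp only [F, w, Sum.elim_inl, Sum.elim_inr, smul_neg, Finset.sum_neg_distrib]
    rw [← hut, add_assoc, add_comm t, ← add_assoc, eq_comm, add_eq_right, add_neg_eq_zero]
    exact Finset.sum_congr rfl fun i _ => by rw [Algebra.smul_def, mul_comm]; rfl
  have htF : t ∈ (Ideal.span (Set.range F)).map (algebraMap R B) := by
    rw [htw]
    refine Ideal.sum_mem _ fun s _ => ?_
    rw [Algebra.smul_def]
    exact Ideal.mul_mem_right _ _ (Ideal.mem_map_of_mem _ (Ideal.subset_span ⟨s, rfl⟩))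
  have hle : q ^ n ≤ Ideal.span (Set.range F) := by
    rw [← hg]
    refine Ideal.span_mono ?_
    rintro _ ⟨i, rfl⟩
    exact ⟨Sum.inr i, rfl⟩
  have ht2 := Ideal.inf_map_le_map_mul_of_pow_le hI hle ⟨ht, htF⟩
  rw [Ideal.map_span, ← Set.range_comp] at ht2
  obtain ⟨y, hy, hty⟩ := exists_sum_of_mem_span_range_mul ht2
  have hrel : ∑ s, F s • (w s - y s) = 0 := by
    simp only [smul_sub, Finset.sum_sub_distrib]
    rw [← htw, sub_eq_zero, hty]
    exact Finset.sum_congr rfl fun s _ => (Algebra.smul_def _ _).symm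
  obtain ⟨k, r, z, hz, hr⟩ :=
    Module.Flat.isTrivialRelation_of_sum_smul_eq_zero (R := R) (M := B) hrel
  refine ⟨k, fun i => r (Sum.inl i), fun j => Ideal.Quotient.mk I (z j), fun i => ?_, fun j => ?_⟩
  · have h3 : b i = ∑ j, r (Sum.inl i) j • z j + y (Sum.inl i) := eq_add_of_sub_eq (hz (Sum.inl i))
    rw [← hb i, h3, map_add, Ideal.Quotient.eq_zero_iff_mem.mpr (hy _), add_zero, map_sum]
    rfl
  · have h4 := hr j
    rw [Fintype.sum_sum_type] at h4
    refine (congrArg (· ∈ q ^ n) (eq_neg_of_add_eq_zero_left h4)).mpr ?_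
    rw [← hg]
    refine Submodule.neg_mem _ (Submodule.sum_mem _ fun i _ => Ideal.mul_mem_right _ _ ?_)
    exact Submodule.subset_span ⟨i, rfl⟩

end IdealMulInf

theorem exists_flatModPow_surjective {R : Type u} [CommRing R] [IsNoetherianRing R] {S : Type v}
    [CommRing S] [IsLocalRing S] [Algebra R S] {q : Ideal R} [q.IsMaximal]
    (hq : q.map (algebraMap R S) = maximalIdeal S) :
    ∃ (C : Type max u v) (_ : CommRing C) (_ : Algebra R C) (π : C →ₐ[R] S), Surjective π ∧
      (q.map (algebraMap R C)).IsMaximal ∧ FlatModPow q C := by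
  obtain ⟨R', _, _, _, _, _, _, hflat, hqR', halg⟩ := exists_flat_isAlgebraic_residueField hq
  have hm : (maximalIdeal R').map (algebraMap R' S) = maximalIdeal S := by
    rw [← hqR', Ideal.map_map, ← IsScalarTower.algebraMap_eq, hq]
  obtain ⟨I, hI1, hI2, hI3⟩ := exists_isResidueLift_univ hm
  dsimp only at hI1 hI2 hI3
  have hQ : q.map (algebraMap R (MvPolynomial S R')) =
      (maximalIdeal R').map MvPolynomial.C := by
    rw [← hqR', Ideal.map_map]
    rfl
  have hflatB : Module.Flat R (MvPolynomial S R') := Module.Flat.trans R R' _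
  let ψ : MvPolynomial S R' →ₐ[R] S := (MvPolynomial.aeval (R := R') (id : S → S)).restrictScalars R
  let π : MvPolynomial S R' ⧸ I →ₐ[R] S := Ideal.Quotient.liftₐ I ψ fun a ha => hI1 ha
  have hπ : ∀ b, π (Ideal.Quotient.mk I b) = ψ b := fun b => rfl
  have hπs : Surjective π := fun t => ⟨Ideal.Quotient.mk I (MvPolynomial.X t), by
    rw [hπ]
    exact MvPolynomial.aeval_X _ t⟩
  refine ⟨MvPolynomial S R' ⧸ I, inferInstance, inferInstance, π, hπs, ?_, ?_⟩
  · have heq : q.map (algebraMap R (MvPolynomial S R' ⧸ I)) =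
        (maximalIdeal S).comap (π : MvPolynomial S R' ⧸ I →+* S) := by
      refine le_antisymm ?_ fun x hx => ?_
      · rw [← Ideal.map_le_iff_le_comap, Ideal.map_map, ← hq]
        exact (congrArg (Ideal.map · q) π.comp_algebraMap).le
      · obtain ⟨b, rfl⟩ := Ideal.Quotient.mk_surjective x
        have h1 : residueSpec R' Set.univ b = 0 := by
          rw [residueSpec_of_supported (by rw [MvPolynomial.supported_univ]; trivial)]
          have h2 : residue S (ψ b) = 0 := (residue_eq_zero_iff _).mpr hx
          exact (congrArg MvPolynomial.C h2).trans (map_zero _)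
        have h3 : b ∈ I ⊔ (maximalIdeal R').map MvPolynomial.C := by
          rw [hI3]
          exact h1
        obtain ⟨i, hi, c, hc, rfl⟩ := Submodule.mem_sup.mp h3
        rw [map_add, Ideal.Quotient.eq_zero_iff_mem.mpr hi, zero_add]
        rw [← hQ] at hc
        have h4 := Ideal.mem_map_of_mem (Ideal.Quotient.mk I) hc
        rw [Ideal.map_map] at h4
        exact h4
    rw [heq]
    exact Ideal.comap_isMaximal_of_surjective _ hπs
  · refine flatModPow_quotient ?_
    rw [hQ]
    exact hI2

/-! ### Adically complete rings with Noetherian quotient are Noetherian. -/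

section AdicNoetherian

open Polynomial

variable {A : Type*} [CommRing A] {I : Ideal A}

/-- The ideal of the Rees algebra attached to a filtration by ideals. -/
def reesIdeal (F : ℕ → Ideal A) (hF : ∀ a b, I ^ a * F b ≤ F (a + b)) : Ideal (reesAlgebra I) where
  carrier := {f | ∀ n, (f : A[X]).coeff n ∈ F n}
  add_mem' := fun {f g} hf hg n => by
    rw [Subalgebra.coe_add, coeff_add]
    exact Ideal.add_mem _ (hf n) (hg n)
  zero_mem' := fun n => by
    rw [Subalgebra.coe_zero, coeff_zero]
    exact Ideal.zero_mem _
  smul_mem' := fun g f hf n => by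
    rw [smul_eq_mul, Subalgebra.coe_mul, coeff_mul]
    refine Ideal.sum_mem _ fun ab hab => ?_
    rw [← Finset.HasAntidiagonal.mem_antidiagonal.mp hab]
    exact hF _ _ (Ideal.mul_mem_mul (g.2 ab.1) (hf ab.2))

/-- This quotient is the associated graded ring, of finite type over `A ⧸ I`. -/
theorem isNoetherianRing_reesAlgebra_quotient (hI : I.FG) [IsNoetherianRing (A ⧸ I)] :
    IsNoetherianRing (reesAlgebra I ⧸ I.map (algebraMap A (reesAlgebra I))) := by
  have h1 : Algebra.FiniteType A (reesAlgebra I) :=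
    (Subalgebra.fg_iff_finiteType _).mp (reesAlgebra.fg hI)
  have h2 : Algebra.FiniteType A (reesAlgebra I ⧸ I.map (algebraMap A (reesAlgebra I))) :=
    h1.of_surjective (Ideal.Quotient.mkₐ A _) (Ideal.Quotient.mkₐ_surjective A _)
  have h3 : Algebra.FiniteType (A ⧸ I) (reesAlgebra I ⧸ I.map (algebraMap A (reesAlgebra I))) :=
    Algebra.FiniteType.of_restrictScalars_finiteType A _ _
  exact Algebra.FiniteType.isNoetherianRing (A ⧸ I)
    (reesAlgebra I ⧸ I.map (algebraMap A (reesAlgebra I)))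

theorem pow_mul_inf_sup_le (J : Ideal A) (a b : ℕ) :
    I ^ a * (J ⊓ I ^ b ⊔ I ^ (b + 1)) ≤ J ⊓ I ^ (a + b) ⊔ I ^ (a + b + 1) := by
  rw [Ideal.mul_sup]
  refine sup_le_sup (le_inf ?_ ?_) ?_
  · exact (Ideal.mul_mono_right inf_le_left).trans Ideal.mul_le_right
  · exact (Ideal.mul_mono_right inf_le_right).trans (pow_add I a b).ge
  · rw [← pow_add, add_assoc]

/-- The `j k` lift homogeneous components of generators of the initial ideal of `J` in the
associated graded ring. Their degrees are at most `D`, whence the exponent `d - D`. -/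
theorem exists_generators_mod_pow (hI : I.FG) [IsNoetherianRing (A ⧸ I)] (J : Ideal A) :
    ∃ (ι : Type) (_ : Fintype ι) (j : ι → A) (D : ℕ), (∀ k, j k ∈ J) ∧
      ∀ d, ∀ y ∈ J, y ∈ I ^ d → ∃ c : ι → A, (∀ k, c k ∈ I ^ (d - D)) ∧
        y - ∑ k, c k * j k ∈ I ^ (d + 1) := by
  have := isNoetherianRing_reesAlgebra_quotient hI
  let H : Ideal (reesAlgebra I) := reesIdeal (fun n => J ⊓ I ^ n ⊔ I ^ (n + 1)) 
    (pow_mul_inf_sup_le J)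
  let K : Ideal (reesAlgebra I) := reesIdeal (fun n => I ^ (n + 1)) fun a b => by
    rw [← pow_add, ← add_assoc]
  have hK : I.map (algebraMap A (reesAlgebra I)) ≤ K := by
    rw [Ideal.map_le_iff_le_comap]
    intro a ha n
    change (C a : A[X]).coeff n ∈ _
    rw [coeff_C]
    split_ifs with hn
    · subst hn
      change a ∈ I ^ (0 + 1)
      rwa [zero_add, pow_one]
    · exact Ideal.zero_mem _
  obtain ⟨s, G, hG⟩ := Submodule.fg_iff_exists_fin_generating_family.mp
    (IsNoetherian.noetherian (H.map (Ideal.Quotient.mk (I.map (algebraMap A (reesAlgebra I))))))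
  have hGm : ∀ i, ∃ f ∈ H, Ideal.Quotient.mk (I.map (algebraMap A (reesAlgebra I))) f = G i :=
    fun i => (Ideal.mem_map_iff_of_surjective _ Ideal.Quotient.mk_surjective).mp
      (hG ▸ Submodule.subset_span ⟨i, rfl⟩)
  choose f hfH hfG using hGm
  have hj : ∀ (i : Fin s) (b : ℕ), ∃ j ∈ J ⊓ I ^ b, (f i : A[X]).coeff b - j ∈ I ^ (b + 1) := by
    intro i b
    obtain ⟨j, hj, t, ht, hjt⟩ := Submodule.mem_sup.mp (hfH i b)
    exact ⟨j, hj, by rw [← hjt, add_sub_cancel_left]; exact ht⟩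
  choose j hjJ hjf using hj
  let D := Finset.univ.sup fun i => (f i : A[X]).natDegree
  have hD : ∀ i, (f i : A[X]).natDegree < D + 1 := fun i =>
    Nat.lt_succ_of_le (Finset.le_sup (f := fun i => (f i : A[X]).natDegree) (Finset.mem_univ i))
  refine ⟨Fin s × Fin (D + 1), inferInstance, fun k => j k.1 k.2, D, fun k => (hjJ k.1 k.2).1,
    fun d y hyJ hyd => ?_⟩
  let Y : reesAlgebra I := ⟨monomial d y, reesAlgebra.monomial_mem.mpr hyd⟩
  have hYH : Y ∈ H := by
    intro n
    change (monomial d y : A[X]).coeff n ∈ _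
    rw [coeff_monomial]
    split_ifs with hn
    · subst hn
      exact Ideal.mem_sup_left ⟨hyJ, hyd⟩
    · exact Ideal.zero_mem _
  have hYG : Ideal.Quotient.mk (I.map (algebraMap A (reesAlgebra I))) Y ∈
      Ideal.span (Set.range G) := by
    have h1 := Ideal.mem_map_of_mem (Ideal.Quotient.mk (I.map (algebraMap A (reesAlgebra I)))) hYH
    rw [← hG] at h1
    exact h1
  obtain ⟨c, hc⟩ := Ideal.mem_span_range_iff_exists_fun.mp hYG
  choose g hg using fun i => Ideal.Quotient.mk_surjective (c i)
  have hYK : Y - ∑ i, g i * f i ∈ K := by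
    refine hK (Ideal.Quotient.eq_zero_iff_mem.mp ?_)
    rw [map_sub, map_sum, ← hc, sub_eq_zero]
    exact Finset.sum_congr rfl fun i _ => by rw [map_mul, hg, hfG]
  have hcoeff := hYK d
  rw [Subalgebra.coe_sub, coeff_sub] at hcoeff
  -- Without the guard, truncated subtraction would select the coefficient of degree 0 whenever `k.2
  -- > d`.
  let γ : Fin s × Fin (D + 1) → A := fun k =>
    if (k.2 : ℕ) ≤ d then (g k.1 : A[X]).coeff (d - k.2) else 0
  have hsum : ((∑ i, g i * f i : reesAlgebra I) : A[X]).coeff d =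
      ∑ k, γ k * (f k.1 : A[X]).coeff k.2 := by
    rw [Fintype.sum_prod_type, AddSubmonoidClass.coe_finsetSum, finsetSum_coeff]
    refine Finset.sum_congr rfl fun i _ => ?_
    rw [Subalgebra.coe_mul]
    conv_lhs => rw [(f i : A[X]).as_sum_range_C_mul_X_pow' (hD i), Finset.mul_sum]
    rw [finsetSum_coeff, Finset.sum_range]
    refine Finset.sum_congr rfl fun b _ => ?_
    rw [← mul_assoc, coeff_mul_X_pow', mul_comm, coeff_C_mul]
    simp only [γ]
    split_ifs
    · ring
    · ring
  refine ⟨γ, fun k => ?_, ?_⟩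
  · simp only [γ]
    split_ifs
    · exact Ideal.pow_le_pow_right (by omega) ((g k.1).2 _)
    · exact Ideal.zero_mem _
  · have hy : (Y : A[X]).coeff d = y := by
      change (monomial d y : A[X]).coeff d = y
      rw [coeff_monomial, if_pos rfl]
    rw [hsum, hy] at hcoeff
    have hsplit : y - ∑ k, γ k * j k.1 k.2 = (y - ∑ k, γ k * (f k.1 : A[X]).coeff k.2) +
        ∑ k, γ k * ((f k.1 : A[X]).coeff k.2 - j k.1 k.2) := by
      simp only [mul_sub, Finset.sum_sub_distrib]
      ring
    rw [hsplit]
    refine Ideal.add_mem _ hcoeff (Ideal.sum_mem _ fun k _ => ?_)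
    simp only [γ]
    split_ifs with hk
    · have h2 := Ideal.mul_mem_mul ((g k.1).2 (d - k.2)) (hjf k.1 k.2)
      rw [← pow_add] at h2
      have h3 : d - (k.2 : ℕ) + (k.2 + 1) = d + 1 := by omega
      rwa [h3] at h2
    · rw [zero_mul]
      exact Ideal.zero_mem _

theorem isNoetherianRing_of_isAdicComplete (hI : I.FG) [IsAdicComplete I A]
    [IsNoetherianRing (A ⧸ I)] : IsNoetherianRing A := by
  refine ⟨fun J => ?_⟩
  obtain ⟨ι, _, j, D, hjJ, hstep⟩ := exists_generators_mod_pow hI J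
  have hfg : Ideal.span (Set.range j) = J := by
    refine le_antisymm (Ideal.span_le.mpr ?_) fun y hy => ?_
    · rintro _ ⟨k, rfl⟩
      exact hjJ k
    choose! c hc hcy using hstep
    let y' : ℕ → A := fun n => Nat.rec y (fun d z => z - ∑ k, c d z k * j k) n
    have hy'0 : y' 0 = y := rfl
    have hy's : ∀ d, y' (d + 1) = y' d - ∑ k, c d (y' d) k * j k := fun d => rfl
    have hy' : ∀ d, y' d ∈ J ∧ y' d ∈ I ^ d := by
      intro d
      induction d with
      | zero => exact ⟨hy, by rw [pow_zero, Ideal.one_eq_top]; trivial⟩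
      | succ d ih =>
        rw [hy's]
        refine ⟨Ideal.sub_mem _ ih.1 (Ideal.sum_mem _
            fun k _ => Ideal.mul_mem_left _ _ (hjJ k)), ?_⟩
        exact hcy d _ ih.1 ih.2
    -- The shift by `D` offsets the loss in `d - D`: terms beyond `p k n` lie in `I ^ n`, so the
    -- partial sums converge.
    let p : ι → ℕ → A := fun k n => ∑ d ∈ Finset.range (n + D), c d (y' d) k
    have hp : ∀ n, y - ∑ k, p k n * j k = y' (n + D) := by
      intro n
      have h1 : ∀ m, y - ∑ k, (∑ d ∈ Finset.range m, c d (y' d) k) * j k = y' m := by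
        intro m
        induction m with
        | zero => simp [hy'0]
        | succ m ih =>
          simp only [Finset.sum_range_succ, add_mul, Finset.sum_add_distrib]
          rw [hy's, ← sub_sub, ih]
      exact h1 (n + D)
    have hlim : ∀ k, ∃ L : A, ∀ n, p k n - L ∈ I ^ n := by
      intro k
      obtain ⟨L, hL⟩ := IsPrecomplete.prec' (I := I) (p k) fun {m n} hmn => by
        rw [SModEq.sub_mem, smul_eq_mul, Ideal.mul_top, ← neg_mem_iff, neg_sub]
        simp only [p]
        rw [← Finset.sum_sdiff_eq_sub (Finset.range_mono (by omega))]
        refine Ideal.sum_mem _ fun d hd => ?_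
        rw [Finset.mem_sdiff, Finset.mem_range, Finset.mem_range] at hd
        exact Ideal.pow_le_pow_right (by omega) (hc d _ (hy' d).1 (hy' d).2 k)
      refine ⟨L, fun n => ?_⟩
      have := hL n
      rwa [SModEq.sub_mem, smul_eq_mul, Ideal.mul_top] at this
    choose L hL using hlim
    have hzero : y - ∑ k, L k * j k = 0 := by
      refine IsHausdorff.haus' (I := I) _ fun n => ?_
      rw [SModEq.zero, smul_eq_mul, Ideal.mul_top]
      have h1 : y - ∑ k, L k * j k = y' (n + D) + ∑ k, (p k n - L k) * j k := by
        rw [← hp n]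
        simp only [sub_mul, Finset.sum_sub_distrib]
        ring
      rw [h1]
      exact Ideal.add_mem _ (Ideal.pow_le_pow_right (by omega) (hy' _).2)
        (Ideal.sum_mem _ fun k _ => Ideal.mul_mem_right _ _ (hL k n))
    rw [sub_eq_zero.mp hzero]
    exact Ideal.sum_mem _ fun k _ => Ideal.mul_mem_left _ _ (Ideal.subset_span ⟨k, rfl⟩)
  rw [← hfg]
  exact Submodule.fg_span (Set.finite_range j)

end AdicNoetherian

/-! ### Flatness of the completion and the Cohen factorization. -/

section FlatCompletion

theorem AdicCompletion.ker_evalₐ_eq_map {C : Type*} [CommRing C] {I : Ideal C} (hI : I.FG) (n : ℕ) :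
    RingHom.ker (AdicCompletion.evalₐ I n) =
      (I ^ n).map (algebraMap C (AdicCompletion I C)) := by
  ext x
  have h1 : x ∈ RingHom.ker (AdicCompletion.evalₐ I n) ↔ x ∈ (AdicCompletion.eval I C n).ker := by
    have heq : I ^ n • (⊤ : Ideal C) = I ^ n := by rw [smul_eq_mul, Ideal.mul_top]
    rw [RingHom.mem_ker, LinearMap.mem_ker]
    constructor
    · intro h
      rw [← AdicCompletion.factor_evalₐ_eq_eval I x heq.ge, h, _root_.map_zero]
    · intro h
      rw [← AdicCompletion.factor_eval_eq_evalₐ I x heq.le, h]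
      exact _root_.map_zero _
  rw [h1, ← AdicCompletion.pow_smul_top_eq_ker_eval hI, Ideal.smul_top_eq_map]
  rfl

variable {R C A : Type*} [CommRing R] [IsNoetherianRing R] [CommRing C] [CommRing A] [Algebra R C]
  [Algebra R A] [Algebra C A] [IsScalarTower R C A] {q : Ideal R}

/-- Artin–Rees for the ideal of the `f i`: an approximate relation is close to an exact one. -/
theorem exists_add_mem_of_sum_mul_mem_pow (q : Ideal R) {m : ℕ} (f : Fin m → R) :
    ∃ e : ℕ, ∀ n (r : Fin m → R), ∑ i, f i * r i ∈ q ^ (n + e) →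
      ∃ s : Fin m → R, (∀ i, s i ∈ q ^ n) ∧ ∑ i, f i * (r i - s i) = 0 := by
  obtain ⟨e, he⟩ := q.exists_pow_inf_eq_pow_smul (Ideal.span (Set.range f))
  refine ⟨e, fun n r hr => ?_⟩
  have h1 : ∑ i, f i * r i ∈ q ^ (n + e) • (⊤ : Ideal R) ⊓ Ideal.span (Set.range f) := by
    refine ⟨by rwa [smul_eq_mul, Ideal.mul_top], ?_⟩
    exact Ideal.sum_mem _ fun i _ => Ideal.mul_mem_right _ _ (Ideal.subset_span ⟨i, rfl⟩)
  rw [he _ (by omega), Nat.add_sub_cancel] at h1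
  have h2 : ∑ i, f i * r i ∈ Ideal.span (Set.range f) * q ^ n := by
    rw [mul_comm (Ideal.span _)]
    exact (Submodule.smul_mono le_rfl inf_le_right : q ^ n • _
        ≤ q ^ n • Ideal.span (Set.range f)) h1
  obtain ⟨s, hs, hsum⟩ := exists_sum_of_mem_span_range_mul h2
  refine ⟨s, hs, ?_⟩
  simp only [mul_sub, Finset.sum_sub_distrib]
  rw [hsum, sub_self]

/-- By the equational criterion it suffices that `x` lies in the `A`-span `Z` of the relations over
`R`. Approximating `x` from `C`, using flatness modulo `q ^ (n + e)` and correcting by Artin–Rees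
puts `x` in `𝔪^n A^m + Z` for every `n`; Krull's intersection theorem for `A^m / Z` concludes. -/
theorem flat_of_flatModPow [IsLocalRing A] [IsNoetherianRing A] (hC : FlatModPow q C)
    (hq : q.map (algebraMap R A) ≤ maximalIdeal A)
    (happrox : ∀ (n : ℕ) (a : A), ∃ c : C, a - algebraMap C A c ∈ (q ^ n).map (algebraMap R A))
    (hcomap : ∀ (n : ℕ) (c : C), algebraMap C A c ∈ (q ^ n).map (algebraMap R A) →
      c ∈ (q ^ n).map (algebraMap R C)) : Module.Flat R A := by
  refine Module.Flat.of_forall_isTrivialRelation fun {m f x} hfx => ?_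
  let ρ : (Fin m → R) → (Fin m → A) := fun r i => algebraMap R A (r i)
  let Z : Submodule A (Fin m → A) := Submodule.span A (ρ '' {r | ∑ i, f i * r i = 0})
  obtain ⟨e, he⟩ := exists_add_mem_of_sum_mul_mem_pow q f
  have key : ∀ n, x ∈ (maximalIdeal A) ^ n • (⊤ : Submodule A (Fin m → A)) ⊔ Z := by
    intro n
    have hpow : ∀ k, (q ^ k).map (algebraMap R A) ≤ maximalIdeal A ^ k := fun k => by
      rw [Ideal.map_pow]
      exact Ideal.pow_right_mono hq k
    have hpi : ∀ z : Fin m → A, (∀ i, z i ∈ maximalIdeal A ^ n) →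
        z ∈ (maximalIdeal A) ^ n • (⊤ : Submodule A (Fin m → A)) := by
      intro z hz
      rw [pi_eq_sum_univ' z]
      exact Submodule.sum_mem _ fun i _ => Submodule.smul_mem_smul (hz i) trivial
    choose c hc using fun i => happrox (n + e) (x i)
    have hfc : ∑ i, f i • c i ∈ (q ^ (n + e)).map (algebraMap R C) := by
      refine hcomap _ _ ?_
      have h1 : algebraMap C A (∑ i, f i • c i) =
          ∑ i, f i • x i - ∑ i, f i • (x i - algebraMap C A (c i)) := by
        rw [map_sum, ← Finset.sum_sub_distrib]
        refine Finset.sum_congr rfl fun i _ => ?_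
        rw [← smul_sub, sub_sub_cancel, Algebra.smul_def, Algebra.smul_def, map_mul,
          ← IsScalarTower.algebraMap_apply]
      rw [h1, hfx, zero_sub]
      refine Submodule.neg_mem _ (Ideal.sum_mem _ fun i _ => ?_)
      rw [Algebra.smul_def]
      exact Ideal.mul_mem_left _ _ (hc i)
    obtain ⟨k, r, y, hcy, hr⟩ := hC _ _ f c hfc
    choose s hs hrs using fun j => he n (fun i => r i j) (hr j)
    have hx : x = (fun i => (x i - algebraMap C A (c i)) +
        ∑ j, algebraMap C A (y j) * algebraMap R A (s j i)) +
        ∑ j, algebraMap C A (y j) • ρ (fun i => r i j - s j i) := by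
      funext i
      simp only [Pi.add_apply, Finset.sum_apply, Pi.smul_apply, smul_eq_mul, ρ, map_sub, mul_sub,
        Finset.sum_sub_distrib]
      have h2 : algebraMap C A (c i) = ∑ j, algebraMap C A (y j) * algebraMap R A (r i j) := by
        rw [hcy i, map_sum]
        refine Finset.sum_congr rfl fun j _ => ?_
        rw [Algebra.smul_def, map_mul, ← IsScalarTower.algebraMap_apply, mul_comm]
      rw [h2]
      ring
    rw [hx]
    refine Submodule.add_mem _ (Submodule.mem_sup_left (hpi _ fun i => ?_))
      (Submodule.mem_sup_right (Submodule.sum_mem _ fun j _ => Submodule.smul_mem _ _ ?_))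
    · refine Ideal.add_mem _ (Ideal.pow_le_pow_right (by omega) (hpow _ (hc i)))
        (Ideal.sum_mem _ fun j _ => Ideal.mul_mem_left _ _
            (hpow n (Ideal.mem_map_of_mem _ (hs j i))))
    · exact Submodule.subset_span ⟨_, hrs j, rfl⟩
  have hxZ : x ∈ Z := by
    rw [← Submodule.Quotient.mk_eq_zero]
    refine IsHausdorff.haus' (I := maximalIdeal A) _ fun n => ?_
    rw [SModEq.zero]
    have h1 := Submodule.mem_map_of_mem (f := Z.mkQ) (key n)
    rw [Submodule.map_sup, Z.mkQ_map_self, sup_bot_eq, Submodule.map_smul''] at h1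
    exact Submodule.smul_mono le_rfl le_top h1
  obtain ⟨k, g, w, hw⟩ := Submodule.mem_span_set'.mp hxZ
  choose r hr hrw using fun j => (w j).2
  refine ⟨k, fun i j => r j i, g, fun i => ?_, hr⟩
  rw [← hw, Finset.sum_apply]
  refine Finset.sum_congr rfl fun j _ => ?_
  rw [Pi.smul_apply, smul_eq_mul, Algebra.smul_def, mul_comm, ← hrw j]

end FlatCompletion

/-- `A` is the completion of `C` at `qC`, and completeness of `S` extends `C → S` to it. -/
theorem exists_flat_isLocalRing_surjective {R : Type u} [CommRing R] [IsNoetherianRing R]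
    {S : Type v} [CommRing S] [IsLocalRing S] [IsAdicComplete (maximalIdeal S) S] [Algebra R S]
    {q : Ideal R} [q.IsMaximal] (hq : q.map (algebraMap R S) = maximalIdeal S) :
    ∃ (A : Type max u v) (_ : CommRing A) (_ : IsLocalRing A) (_ : Algebra R A) (φ : A →ₐ[R] S),
      IsNoetherianRing A ∧ Module.Flat R A ∧ q.map (algebraMap R A) = maximalIdeal A ∧
      Surjective φ := by
  obtain ⟨C, _, _, π, hπ, hmax, hC⟩ := exists_flatModPow_surjective hq
  set I := q.map (algebraMap R C) with hI
  have hfg : I.FG := Ideal.FG.map (IsNoetherian.noetherian q) _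
  have : IsScalarTower R C (AdicCompletion I C) := IsScalarTower.of_algebraMap_eq fun _ => rfl
  set m := I.map (algebraMap C (AdicCompletion I C)) with hm
  have hm_max : m.IsMaximal := AdicCompletion.isMaximal_map_of_le I I le_rfl hfg
  have hcompl : IsAdicComplete m (AdicCompletion I C) := AdicCompletion.isAdicComplete_self I hfg
  have hloc : IsLocalRing (AdicCompletion I C) := isLocalRing_of_isAdicComplete_maximal m
  have hmm : m = maximalIdeal (AdicCompletion I C) := eq_maximalIdeal hm_max
  have hnoeth : IsNoetherianRing (AdicCompletion I C) := by
    let _ := Ideal.Quotient.field m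
    exact isNoetherianRing_of_isAdicComplete (I := m) (hfg.map _)
  have hpow : ∀ n, (q ^ n).map (algebraMap R (AdicCompletion I C)) =
      RingHom.ker (AdicCompletion.evalₐ I n) := fun n => by
    rw [AdicCompletion.ker_evalₐ_eq_map hfg, hI, ← Ideal.map_pow, Ideal.map_map,
      ← IsScalarTower.algebraMap_eq]
  have heval : ∀ n (c : C), AdicCompletion.evalₐ I n (algebraMap C _ c) =
      Ideal.Quotient.mk (I ^ n) c := fun n c => AdicCompletion.evalₐ_of I n c
  have hIS : I ≤ (maximalIdeal S).comap (π : C →+* S) := by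
    rw [← Ideal.map_le_iff_le_comap, hI, Ideal.map_map, ← hq]
    exact (congrArg (Ideal.map · q) π.comp_algebraMap).le
  have hIn : ∀ n, I ^ n ≤ (maximalIdeal S ^ n).comap (π : C →+* S) := fun n =>
    (Ideal.pow_right_mono hIS n).trans (Ideal.le_comap_pow _ n)
  let f : (n : ℕ) → AdicCompletion I C →ₐ[R] S ⧸ maximalIdeal S ^ n := fun n =>
    (Ideal.quotientMapₐ (maximalIdeal S ^ n) π (hIn n)).comp
      ((AdicCompletion.evalₐ I n).restrictScalars R)
  have hf : ∀ {k n : ℕ} (hle : k ≤ n),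
      (Ideal.Quotient.factorₐ R (Ideal.pow_le_pow_right hle)).comp (f n) = f k := by
    intro k n hle
    refine AlgHom.ext fun a => ?_
    obtain ⟨c, hc⟩ := Ideal.Quotient.mk_surjective (AdicCompletion.evalₐ I n a)
    have hak : AdicCompletion.evalₐ I k a = Ideal.Quotient.mk (I ^ k) c := by
      have h1 : a - algebraMap C _ c ∈ RingHom.ker (AdicCompletion.evalₐ I n) := by
        rw [RingHom.mem_ker, map_sub, heval, hc, sub_self]
      have h2 : a - algebraMap C _ c ∈ RingHom.ker (AdicCompletion.evalₐ I k) := by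
        rw [← hpow] at h1 ⊢
        exact Ideal.map_mono (Ideal.pow_le_pow_right hle) h1
      rwa [RingHom.mem_ker, map_sub, heval, sub_eq_zero] at h2
    change Ideal.Quotient.factor (Ideal.pow_le_pow_right hle)
        (Ideal.quotientMapₐ (maximalIdeal S ^ n) π (hIn n)
      (AdicCompletion.evalₐ I n a)) = Ideal.quotientMapₐ (maximalIdeal S ^ k) π (hIn k)
      (AdicCompletion.evalₐ I k a)
    rw [hak, ← hc]
    rfl
  refine ⟨AdicCompletion I C, inferInstance, hloc, inferInstance,
    IsAdicComplete.liftAlgHom (maximalIdeal S) f hf, hnoeth, ?_, ?_, fun t => ?_⟩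
  · refine flat_of_flatModPow (C := C) hC ?_ (fun n a => ?_) fun n c hc => ?_
    · rw [← hmm, hm, hI, Ideal.map_map, ← IsScalarTower.algebraMap_eq]
    · obtain ⟨c, hc⟩ := Ideal.Quotient.mk_surjective (AdicCompletion.evalₐ I n a)
      refine ⟨c, ?_⟩
      rw [hpow, RingHom.mem_ker, map_sub, heval, hc, sub_self]
    · rw [hpow, RingHom.mem_ker, heval, Ideal.Quotient.eq_zero_iff_mem] at hc
      rwa [Ideal.map_pow]
  · rw [← hmm, hm, hI, Ideal.map_map, ← IsScalarTower.algebraMap_eq]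
  -- The extended map restricts on `C` to `π`, which is already onto.
  · obtain ⟨c, rfl⟩ := hπ t
    refine ⟨algebraMap C _ c, ?_⟩
    rw [← sub_eq_zero]
    refine IsHausdorff.haus' (I := maximalIdeal S) _ fun n => ?_
    rw [SModEq.zero, smul_eq_mul, Ideal.mul_top, ← Ideal.Quotient.eq_zero_iff_mem, map_sub,
      IsAdicComplete.mk_liftAlgHom, sub_eq_zero]
    change Ideal.quotientMapₐ (maximalIdeal S ^ n) π (hIn n)
      (AdicCompletion.evalₐ I n (algebraMap C _ c)) = _
    rw [heval]
    rfl

/-! ### Assembly of the inequality. -/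

theorem ringKrullDim_le_of_flat {R : Type u} {S : Type v} [CommRing R] [IsLocalRing R]
    [IsNoetherianRing R] [CommRing S] [IsLocalRing S] [IsNoetherianRing S] [Algebra R S]
    [IsLocalHom (algebraMap R S)] [Module.Flat R S] : ringKrullDim R ≤ ringKrullDim S := by
  have : (maximalIdeal S).LiesOver (maximalIdeal R) := ⟨(maximalIdeal_comap (algebraMap R S)).symm⟩
  have h := Ideal.height_eq_height_add_of_liesOver_of_hasGoingDown (maximalIdeal R) (maximalIdeal S)
  rw [← maximalIdeal_height_eq_ringKrullDim, ← maximalIdeal_height_eq_ringKrullDim, h]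
  exact_mod_cast le_self_add

/-- In a minimal generating set, a unit coefficient in a relation modulo 𝔪² would let Nakayama
discard a generator. -/
theorem exists_cotangentIndep_maximalIdeal (R : Type u) [CommRing R] [IsLocalRing R]
    [IsNoetherianRing R] : ∃ z : Fin (embDim R) → R, CotangentIndep (maximalIdeal R) z := by
  classical
  obtain ⟨T, hT, hspan⟩ := exists_finset_card_eq_embDim R
  let e : Fin (embDim R) ≃ T := (finCongr hT.symm).trans T.equivFin.symm
  have hzm : ∀ i, (e i : R) ∈ maximalIdeal R := fun i => hspan ▸ Ideal.subset_span (e i).2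
  refine ⟨fun i => e i, hzm, fun r hr i => ?_⟩
  by_contra hi
  have hunit : IsUnit (r i) := by
    by_contra h
    exact hi ((mem_maximalIdeal _).mpr h)
  let T' := T.erase (e i)
  have hT' : (T' : Set R) ⊆ maximalIdeal R := fun x hx =>
    hspan ▸ Ideal.subset_span (Finset.mem_of_mem_erase hx)
  have hei : (e i : R) ∈ Ideal.span (T' : Set R) ⊔ maximalIdeal R ^ 2 := by
    rw [← Ideal.unit_mul_mem_iff_mem _ hunit]
    rw [← Finset.add_sum_erase _ _ (Finset.mem_univ i)] at hr
    have h1 : ∑ j ∈ Finset.univ.erase i, r j * (e j : R) ∈ Ideal.span (T' : Set R) := by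
      refine Ideal.sum_mem _ fun j hj => Ideal.mul_mem_left _ _ (Ideal.subset_span ?_)
      refine Finset.mem_coe.mpr (Finset.mem_erase.mpr ⟨fun h => ?_, (e j).2⟩)
      exact (Finset.mem_erase.mp hj).1 (e.injective (Subtype.ext h))
    rw [← add_sub_cancel_right (r i * (e i : R)) (∑ j ∈ Finset.univ.erase i, r j * (e j : R))]
    exact Ideal.sub_mem _ (Ideal.mem_sup_right hr) (Ideal.mem_sup_left h1)
  have hle : maximalIdeal R ≤ Ideal.span (T' : Set R) := by
    refine Submodule.le_of_le_smul_of_le_jacobson_bot (I := maximalIdeal R)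
      (maximalIdeal R).fg_of_isNoetherianRing (maximalIdeal_le_jacobson _) ?_
    rw [smul_eq_mul, ← sq]
    conv_lhs => rw [← hspan]
    rw [Ideal.span_le]
    intro x hx
    by_cases hxi : x = e i
    · rw [hxi]
      exact hei
    · exact Ideal.mem_sup_left (Ideal.subset_span
          (Finset.mem_coe.mpr (Finset.mem_erase.mpr ⟨hxi, hx⟩)))
  have h2 := embDim_le_card T' (le_antisymm hle (Ideal.span_le.mpr hT'))
  rw [← hT] at h2
  exact absurd (Finset.card_erase_lt_of_mem (e i).2) (not_lt.mpr h2)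

/-- The maximal ideal is minimal over `height` many elements, and every prime lies inside it, so it
is the only prime containing them. -/
theorem exists_finset_radical_eq_maximalIdeal (R : Type u) [CommRing R] [IsLocalRing R]
    [IsNoetherianRing R] : ∃ Y : Finset R, (Y : Set R) ⊆ maximalIdeal R ∧
      maximalIdeal R ≤ (Ideal.span (Y : Set R)).radical ∧ Y.card ≤ dimNat R := by
  obtain ⟨Y, hY, hcard⟩ := (maximalIdeal R).exists_finset_card_eq_height_of_isNoetherianRing
  refine ⟨Y, Ideal.subset_span.trans hY.1.2, ?_, ?_⟩
  · rw [Ideal.radical_eq_sInf]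
    refine le_sInf fun p hp => ?_
    have := hp.2
    exact hY.2 ⟨hp.2, hp.1⟩ (le_maximalIdeal hp.2.ne_top)
  · have h1 : ((Y.card : ℕ∞) : WithBot ℕ∞) = ((dimNat R : ℕ) : WithBot ℕ∞) := by
      rw [hcard, coe_dimNat, maximalIdeal_height_eq_ringKrullDim]
    exact le_of_eq (by exact_mod_cast h1)

theorem FlatBase.nonempty_of_flatDimLE {R : Type u} {S : Type v} [CommRing R] [IsLocalRing R]
    [IsNoetherianRing R] [CommRing S] [IsLocalRing S] [Algebra R S] {n : ℕ}
    (h : FlatDimLE R n S) : Nonempty (FlatBase.{u} S ((maximalIdeal R).map (algebraMap R S))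
      (embDim R) (dimNat R)) :=
  ⟨{  carrier := R
      ideal := maximalIdeal R
      map_eq := rfl
      exists_cotangentIndep := exists_cotangentIndep_maximalIdeal R
      exists_finset := exists_finset_radical_eq_maximalIdeal R
      exists_flatDimLE := ⟨n, h⟩ }⟩

theorem FlatBase.sub_le_of_isAdicComplete {S : Type v} [CommRing S] [IsLocalRing S]
    [IsNoetherianRing S] [IsAdicComplete (maximalIdeal S) S] {g d : ℕ}
    (B : FlatBase.{u} S (maximalIdeal S) g d) : (g : ℤ) - d ≤ embDim S - dimNat S := by
  obtain ⟨A, _, _, _, φ, _, _, hqA, hφ⟩ := exists_flat_isLocalRing_surjective B.map_eq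
  obtain ⟨z, hz⟩ := B.exists_cotangentIndep
  obtain ⟨Y, hY, hYr, hYc⟩ := B.exists_finset
  obtain ⟨n, hn⟩ := B.exists_flatDimLE
  -- This copy of `S` lives in the universe of `A`, as `FinFreeRes` demands.
  let e : (A ⧸ RingHom.ker φ) ≃ₐ[B.carrier] S := Ideal.quotientKerAlgEquivOfSurjective hφ
  have : Nontrivial (A ⧸ RingHom.ker φ) := e.toEquiv.nontrivial
  have : IsLocalRing (A ⧸ RingHom.ker φ) :=
    IsLocalRing.of_surjective' _ Ideal.Quotient.mk_surjective
  have hres : FinFreeRes A n (A ⧸ RingHom.ker φ) :=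
    finFreeRes_of_flatDimLE hqA _ (hn.of_equiv e.symm.toLinearEquiv)
  have h1 := embDim_sub_dimNat_le_of_surjective (A := A) (S := A ⧸ RingHom.ker φ)
    Ideal.Quotient.mk_surjective hres
  have h2 : embDim (A ⧸ RingHom.ker φ) ≤ embDim S := by
    refine embDim_le_of_ker_le_sq (φ := (e : A ⧸ RingHom.ker φ →+* S)) e.surjective ?_
    exact ((RingHom.injective_iff_ker_eq_bot (e : A ⧸ RingHom.ker φ →+* S)).mp e.injective).le.trans
      bot_le
  have h3 : dimNat (A ⧸ RingHom.ker φ) = dimNat S := by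
    rw [dimNat, dimNat, ringKrullDim_eq_of_ringEquiv e.toRingEquiv]
  have h4 := hz.le_embDim hqA
  have h5 : dimNat A ≤ Y.card := by
    have := ringKrullDim_le_of_le_radical hqA hY hYr
    rw [← coe_dimNat] at this
    exact_mod_cast this
  omega

theorem embDim_sub_dimNat_le_of_isAdicComplete {R : Type u} {S : Type v} [CommRing R]
    [IsLocalRing R] [IsNoetherianRing R] [CommRing S] [IsLocalRing S] [IsNoetherianRing S]
    [IsAdicComplete (maximalIdeal S) S] [Algebra R S] [IsLocalHom (algebraMap R S)] {n : ℕ}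
    (h : FlatDimLE R n S) : (embDim R : ℤ) - dimNat R ≤ embDim S - dimNat S := by
  obtain ⟨B⟩ := FlatBase.nonempty_of_flatDimLE h
  obtain ⟨T, -, hT⟩ := exists_finset_card_eq_embDim S
  obtain ⟨B'⟩ := B.exists_adjoin_finset T
  have hle : (maximalIdeal R).map (algebraMap R S) ≤ maximalIdeal S :=
    Ideal.map_le_iff_le_comap.mpr (maximalIdeal_comap (algebraMap R S)).ge
  rw [hT, sup_eq_right.mpr hle] at B'
  have := B'.sub_le_of_isAdicComplete
  push_cast at this
  omega

/-- The completion has the same edim, and dim at least that of `S` by flatness, so its inequality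
implies the one for `S`. -/
theorem embDim_sub_dimNat_le {R : Type u} {S : Type v} [CommRing R] [IsLocalRing R]
    [IsNoetherianRing R] [CommRing S] [IsLocalRing S] [IsNoetherianRing S] [Algebra R S]
    [IsLocalHom (algebraMap R S)] {n : ℕ} (h : FlatDimLE R n S) :
    (embDim R : ℤ) - dimNat R ≤ embDim S - dimNat S := by
  let S' := AdicCompletion (maximalIdeal S) S
  have : IsScalarTower R S S' := IsScalarTower.of_algebraMap_eq fun _ => rfl
  have hS' : IsNoetherianRing S' := by
    let _ := Ideal.Quotient.field (maximalIdeal S')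
    refine isNoetherianRing_of_isAdicComplete (I := maximalIdeal S') ?_
    rw [AdicCompletion.maximalIdeal_eq_map]
    exact Ideal.FG.map (maximalIdeal S).fg_of_isNoetherianRing _
  have : IsLocalHom (algebraMap R S') := by
    rw [IsScalarTower.algebraMap_eq R S S']
    exact RingHom.isLocalHom_comp _ _
  have h1 := embDim_sub_dimNat_le_of_isAdicComplete (h.of_flat_algebra (S' := S'))
  have h2 : embDim S' = embDim S := AdicCompletion.spanFinrank_maximalIdeal_eq
  have h3 : dimNat S ≤ dimNat S' := by
    have := ringKrullDim_le_of_flat (R := S) (S := S')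
    rw [← coe_dimNat, ← coe_dimNat] at this
    exact_mod_cast this
  omega

theorem mainTheorem8 {R : Type u} {S : Type v} [CommRing R] [IsLocalRing R] [IsNoetherianRing R]
    [CommRing S] [IsLocalRing S] [IsNoetherianRing S] [Algebra R S]
    [IsLocalHom (algebraMap R S)] (hfd : HasFiniteFlatDimension R S) :
    ((embDim R : ℤ) - (dimNat R : ℤ) ≤ (embDim S : ℤ) - (dimNat S : ℤ)) ∧
    (ringKrullDim R ≤ ringKrullDim S → embDim R ≤ embDim S) ∧
    (Module.Flat R S → ringKrullDim R ≤ ringKrullDim S) := by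
  obtain ⟨n, hn⟩ := hfd
  have h := embDim_sub_dimNat_le (FlatDimLE.of_hasFlatDimensionLE hn)
  refine ⟨h, fun hdim => ?_, fun _ => ringKrullDim_le_of_flat⟩
  rw [← coe_dimNat, ← coe_dimNat] at hdim
  have hdim' : dimNat R ≤ dimNat S := by exact_mod_cast hdim
  omega
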